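/- Let $D$ be a connected real or complex (finite-dimensional) Lie group whose Lie algebra $\mathfrak d$ carries a nondegenerate invariant symmetric bilinear form $\langle\,,\rangle$. Let $\mathfrak d=\mathfrak u+\mathfrak u'$ be a Lagrangian splitting, i.e. a vector space direct sum of Lie subalgebras with $\mathfrak u^\perp=\mathfrak u$ and $\mathfrak u'^\perp=\mathfrak u'$. Let $U$ and $U'$ be the connected (not necessarily closed) Lie subgroups of $D$ with Lie algebras $\mathfrak u$ and $\mathfrak u'$, and let $N(\mathfrak u)=\{g\in D:\mathrm{Ad}_g\mathfrak u=\mathfrak u\}$ and $N(\mathfrak u')$ be the normalizers of $\mathfrak u$ and $\mathfrak u'$ in $D$. Let $\pi^D_{\mathfrak u,\mathfrak u'}=R^r-R^l$ be the Poisson structure on $D$ given by the difference of the right and left invariant bivector fields with value $R=\frac12\sum_j \xi_j\wedge x_j$ at the identity, where $\{x_j\}$ and $\{\xi_j\}$ are bases of $\mathfrak u$ and $\mathfrak u'$ with $\langle x_i,\xi_j\rangle=\delta_{ij}$. Assume that $N(\mathfrak u)$ and $N(\mathfrak u')$ are connected. Let $X$ be any Poisson space with a Poisson action of $(D,\pi^D_{\mathfrak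 u,\mathfrak u'})$, and let $x\in X$. Then the group $N(\mathfrak u)\cap N(\mathfrak u')$ acts transitively on the (nonempty) set of nonempty intersections of a $U$-orbit with a $U'$-orbit that are contained in $N(\mathfrak u)x\cap N(\mathfrak u')x$. That is, the translate of such an intersection by an element of $N(\mathfrak u)\cap N(\mathfrak u')$ is again one, and any two of them are translates of each other by an element of $N(\mathfrak u)\cap N(\mathfrak u')$. -/

import Mathlib

open scoped Manifold ContDiff Topology
open Filter

namespace PoissonOrbits

/-! ## Lie groups over `ℝ` or `ℂ`

`𝕜` is `ℝ` or `ℂ`.  A manifold of class `C^∞` over `ℝ` is a smooth manifold, over `ℂ` it is a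
complex manifold (a `C^∞` function over `ℂ` is a holomorphic one). -/

section LieGroups

variable {𝕜 : Type*} [RCLike 𝕜] {E : Type*} [NormedAddCommGroup E] [NormedSpace 𝕜 E]
  {D : Type*} [TopologicalSpace D] [ChartedSpace E D] [Group D]

/-- The smoothness needed for the bracket on the Lie algebra is available on smooth
(resp. complex) Lie groups. -/
instance instLEInftyMinSmoothness : ENat.LEInfty (minSmoothness 𝕜 3) := by
  refine ⟨?_⟩
  rw [minSmoothness_of_isRCLikeNormedField]
  exact ENat.LEInfty.out

variable (𝕜 E) in
/-- The adjoint action `Ad g` on the Lie algebra `T₁D`: the derivative at `1` of the conjugation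
`h ↦ g h g⁻¹`. -/
noncomputable def Ad (g : D) : GroupLieAlgebra 𝓘(𝕜, E) D →ₗ[𝕜] GroupLieAlgebra 𝓘(𝕜, E) D :=
  (mfderiv 𝓘(𝕜, E) 𝓘(𝕜, E) (fun h : D => g * h * g⁻¹) (1 : D) : E →L[𝕜] E).toLinearMap

theorem Ad_one : Ad 𝕜 E (1 : D) = LinearMap.id := by
  have h : (fun h : D => 1 * h * 1⁻¹) = id := by ext; simp
  unfold Ad
  rw [h, mfderiv_id]
  rfl

variable [LieGroup 𝓘(𝕜, E) ∞ D]

theorem mdifferentiable_conj (g : D) :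
    MDifferentiable 𝓘(𝕜, E) 𝓘(𝕜, E) (fun h : D => g * h * g⁻¹) := by
  have h1 : ContMDiff 𝓘(𝕜, E) 𝓘(𝕜, E) ∞ (fun h : D => g * h * g⁻¹) :=
    (contMDiff_mul_right (a := g⁻¹)).comp (contMDiff_mul_left (a := g))
  exact h1.mdifferentiable (by simp)

theorem Ad_mul (g h : D) : Ad 𝕜 E (g * h) = Ad 𝕜 E g ∘ₗ Ad 𝕜 E h := by
  have e : (fun k : D => (g * h) * k * (g * h)⁻¹)
      = (fun k : D => g * k * g⁻¹) ∘ (fun k : D => h * k * h⁻¹) := by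
    ext k; simp [mul_assoc]
  have key : ∀ y : D, y = 1 →
      (mfderiv 𝓘(𝕜, E) 𝓘(𝕜, E) (fun k : D => g * k * g⁻¹) y : E →L[𝕜] E)
        = mfderiv 𝓘(𝕜, E) 𝓘(𝕜, E) (fun k : D => g * k * g⁻¹) (1 : D) := by
    rintro y rfl; rfl
  unfold Ad
  rw [e, mfderiv_comp (1 : D) (mdifferentiable_conj g _) (mdifferentiable_conj h _)]
  have := key (h * 1 * h⁻¹) (by simp)
  ext v
  exact DFunLike.congr_fun this _

variable [CompleteSpace E]

/-- The normalizer subgroup `N(𝔲) = {g ∈ D | Ad g (𝔲) = 𝔲}`. -/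
noncomputable def normalizerSubgroup (u : LieSubalgebra 𝕜 (GroupLieAlgebra 𝓘(𝕜, E) D)) :
    Subgroup D where
  carrier := {g | u.toSubmodule.map (Ad 𝕜 E g) = u.toSubmodule}
  one_mem' := by
    change u.toSubmodule.map (Ad 𝕜 E 1) = u.toSubmodule
    rw [Ad_one, Submodule.map_id]
  mul_mem' := by
    intro g h hg hh
    change u.toSubmodule.map (Ad 𝕜 E g) = u.toSubmodule at hg
    change u.toSubmodule.map (Ad 𝕜 E h) = u.toSubmodule at hh
    change u.toSubmodule.map (Ad 𝕜 E (g * h)) = u.toSubmodule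
    rw [Ad_mul, Submodule.map_comp, hh, hg]
  inv_mem' := by
    intro g hg
    change u.toSubmodule.map (Ad 𝕜 E g) = u.toSubmodule at hg
    change u.toSubmodule.map (Ad 𝕜 E g⁻¹) = u.toSubmodule
    have h1 : Ad 𝕜 E g⁻¹ ∘ₗ Ad 𝕜 E g = LinearMap.id := by
      rw [← Ad_mul, inv_mul_cancel, Ad_one]
    conv_lhs => rw [← hg]
    rw [← Submodule.map_comp, h1, Submodule.map_id]

/-- `IsExp X g`: the element `g` is `exp X`, i.e. it is the value at time `1` of a one-parameter
subgroup `γ` of `D` (real or holomorphic, according to `𝕜`) with `γ'(0) = X`. -/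
def IsExp (X : GroupLieAlgebra 𝓘(𝕜, E) D) (g : D) : Prop :=
  ∃ γ : 𝕜 → D, (∀ s t, γ (s + t) = γ s * γ t) ∧ MDifferentiable 𝓘(𝕜, 𝕜) 𝓘(𝕜, E) γ ∧
    (mfderiv 𝓘(𝕜, 𝕜) 𝓘(𝕜, E) γ 0 : 𝕜 →L[𝕜] E) (1 : 𝕜) = X ∧ γ 1 = g

/-- The connected (not necessarily closed) Lie subgroup of `D` with Lie algebra `𝔲`: the subgroup
generated by `exp 𝔲`. -/
def connectedSubgroup (u : LieSubalgebra 𝕜 (GroupLieAlgebra 𝓘(𝕜, E) D)) : Subgroup D :=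
  Subgroup.closure {g | ∃ X ∈ u, IsExp X g}

/-! ## Lagrangian splittings -/

/-- `B` makes the Lie algebra of `D` a quadratic Lie algebra: it is a nondegenerate invariant
symmetric bilinear form. -/
structure IsQuadratic (B : LinearMap.BilinForm 𝕜 (GroupLieAlgebra 𝓘(𝕜, E) D)) : Prop where
  symm : ∀ x y, B x y = B y x
  nondegenerate : ∀ x, (∀ y, B x y = 0) → x = 0
  invariant : ∀ x y z, B ⁅x, y⁆ z = B x ⁅y, z⁆

/-- A Lie subalgebra `𝔩` is Lagrangian: `𝔩^⊥ = 𝔩`. -/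
def IsLagrangian (B : LinearMap.BilinForm 𝕜 (GroupLieAlgebra 𝓘(𝕜, E) D))
    (l : LieSubalgebra 𝕜 (GroupLieAlgebra 𝓘(𝕜, E) D)) : Prop :=
  ∀ x, x ∈ l ↔ ∀ y ∈ l, B x y = 0

/-- A Lagrangian splitting `𝔡 = 𝔲 + 𝔲'` (a vector space direct sum of Lagrangian subalgebras). -/
structure IsLagrangianSplitting (B : LinearMap.BilinForm 𝕜 (GroupLieAlgebra 𝓘(𝕜, E) D))
    (u u' : LieSubalgebra 𝕜 (GroupLieAlgebra 𝓘(𝕜, E) D)) : Prop where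
  left : IsLagrangian B u
  right : IsLagrangian B u'
  isCompl : IsCompl u.toSubmodule u'.toSubmodule

/-! ## The Poisson structure on `D`

The `r`-matrix is `R = ½ ∑ⱼ ξⱼ ∧ xⱼ`, where `(xⱼ)`, `(ξⱼ)` are dual bases of `𝔲` and `𝔲'`, and the
Poisson structure on `D` is the bivector field `R^r - R^l`.  A bivector at a point is described by
its values on pairs of covectors, `(v ∧ w)(α, β) = α(v) β(w) - α(w) β(v)`. -/

/-- The value at `d` of the right invariant vector field with value `v` at `1`. -/
noncomputable def rightInvariantField (v : GroupLieAlgebra 𝓘(𝕜, E) D) (d : D) :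
    TangentSpace 𝓘(𝕜, E) d :=
  (mfderiv 𝓘(𝕜, E) 𝓘(𝕜, E) (fun h : D => h * d) (1 : D) : E →L[𝕜] E) v

/-- The value at `d` of the left invariant vector field with value `v` at `1`. -/
noncomputable def leftInvariantField (v : GroupLieAlgebra 𝓘(𝕜, E) D) (d : D) :
    TangentSpace 𝓘(𝕜, E) d :=
  (mfderiv 𝓘(𝕜, E) 𝓘(𝕜, E) (fun h : D => d * h) (1 : D) : E →L[𝕜] E) v

/-- The value of the bivector `v ∧ w` on the covectors `α`, `β`. -/
def wedge {V : Type*} [AddCommGroup V] [Module 𝕜 V] [TopologicalSpace V] (v w : V)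
    (α β : V →L[𝕜] 𝕜) : 𝕜 :=
  α v * β w - α w * β v

variable {n : ℕ} {u u' : LieSubalgebra 𝕜 (GroupLieAlgebra 𝓘(𝕜, E) D)}

/-- The bases `x` of `𝔲` and `ξ` of `𝔲'` are dual with respect to `B`. -/
def IsDual (B : LinearMap.BilinForm 𝕜 (GroupLieAlgebra 𝓘(𝕜, E) D))
    (x : Module.Basis (Fin n) 𝕜 u) (ξ : Module.Basis (Fin n) 𝕜 u') : Prop :=
  ∀ i j, B (x i) (ξ j) = if i = j then 1 else 0

/-- The bivector field `π^D = R^r - R^l` on `D`, with `R = ½ ∑ⱼ ξⱼ ∧ xⱼ`, evaluated at `d` on a pair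
of covectors. -/
noncomputable def groupBivector (x : Module.Basis (Fin n) 𝕜 u) (ξ : Module.Basis (Fin n) 𝕜 u')
    (d : D) (α β : TangentSpace 𝓘(𝕜, E) d →L[𝕜] 𝕜) : 𝕜 :=
  (1 / 2 : 𝕜) * ∑ j, wedge (rightInvariantField (ξ j : GroupLieAlgebra 𝓘(𝕜, E) D) d)
      (rightInvariantField (x j : GroupLieAlgebra 𝓘(𝕜, E) D) d) α β
    - (1 / 2 : 𝕜) * ∑ j, wedge (leftInvariantField (ξ j : GroupLieAlgebra 𝓘(𝕜, E) D) d)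
      (leftInvariantField (x j : GroupLieAlgebra 𝓘(𝕜, E) D) d) α β

/-- The Poisson bracket `{φ, ψ}(d) = π^D(d)(dφ, dψ)` of two functions on `D`. -/
noncomputable def groupBracket (x : Module.Basis (Fin n) 𝕜 u) (ξ : Module.Basis (Fin n) 𝕜 u')
    (φ ψ : D → 𝕜) (d : D) : 𝕜 :=
  groupBivector x ξ d (mfderiv 𝓘(𝕜, E) 𝓘(𝕜, 𝕜) φ d : E →L[𝕜] 𝕜)
    (mfderiv 𝓘(𝕜, E) 𝓘(𝕜, 𝕜) ψ d : E →L[𝕜] 𝕜)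

end LieGroups

/-! ## Poisson spaces -/

/-- A sheaf of continuous `𝕜`-valued functions on `X` that is closed under smooth (holomorphic, if
`𝕜 = ℂ`) operations.  The sheaf is given by the predicate `IsRegular f p`, which says that `f` is a
section of it in a neighbourhood of `p`; the sections over an open set `V` are the functions that
are regular at each point of `V`.  Examples are the smooth functions on a manifold, the
holomorphic functions on a complex manifold or on a reduced complex analytic space, and the
restrictions of smooth functions to a (possibly singular) subset of a manifold. -/
class RegularFunctions (𝕜 : Type*) [RCLike 𝕜] (X : Type*) [TopologicalSpace X] where
  IsRegular : (X → 𝕜) → X → Prop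
  congr : ∀ {f g : X → 𝕜} {p : X}, f =ᶠ[𝓝 p] g → IsRegular f p → IsRegular g p
  eventually : ∀ {f : X → 𝕜} {p : X}, IsRegular f p → ∀ᶠ q in 𝓝 p, IsRegular f q
  continuousAt : ∀ {f : X → 𝕜} {p : X}, IsRegular f p → ContinuousAt f p
  comp : ∀ {m : ℕ} {h : Fin m → X → 𝕜} {p : X} {Φ : (Fin m → 𝕜) → 𝕜},
    (∀ i, IsRegular (h i) p) → (∀ᶠ y in 𝓝 (fun i => h i p), ContDiffAt 𝕜 ∞ Φ y) →
      IsRegular (fun q => Φ (fun i => h i q)) p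

open RegularFunctions

/-- A Poisson space: a space with a sheaf of regular functions as above and a Poisson bracket on
this sheaf.  The function `bracket f g` is meaningful where `f` and `g` are regular.  A Poisson
manifold is a Poisson space, with `bracket f g p = π(p)(df, dg)`. -/
class PoissonSpace (𝕜 : Type*) [RCLike 𝕜] (X : Type*) [TopologicalSpace X] extends
    RegularFunctions 𝕜 X where
  bracket : (X → 𝕜) → (X → 𝕜) → X → 𝕜
  bracket_congr : ∀ {f₁ f₂ g₁ g₂ : X → 𝕜} {p : X}, IsRegular f₁ p → IsRegular g₁ p →
    f₁ =ᶠ[𝓝 p] f₂ → g₁ =ᶠ[𝓝 p] g₂ → bracket f₁ g₁ p = bracket f₂ g₂ p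
  bracket_regular : ∀ {f g : X → 𝕜} {p : X}, IsRegular f p → IsRegular g p →
    IsRegular (bracket f g) p
  bracket_add : ∀ {f g h : X → 𝕜} {p : X}, IsRegular f p → IsRegular g p → IsRegular h p →
    bracket f (fun q => g q + h q) p = bracket f g p + bracket f h p
  bracket_smul : ∀ (c : 𝕜) {f g : X → 𝕜} {p : X}, IsRegular f p → IsRegular g p →
    bracket f (fun q => c * g q) p = c * bracket f g p
  bracket_skew : ∀ {f g : X → 𝕜} {p : X}, IsRegular f p → IsRegular g p →
    bracket f g p = - bracket g f p
  bracket_leibniz : ∀ {f g h : X → 𝕜} {p : X}, IsRegular f p → IsRegular g p → IsRegular h p →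
    bracket f (fun q => g q * h q) p = bracket f g p * h p + g p * bracket f h p
  bracket_jacobi : ∀ {f g h : X → 𝕜} {p : X}, IsRegular f p → IsRegular g p → IsRegular h p →
    bracket f (bracket g h) p + bracket g (bracket h f) p + bracket h (bracket f g) p = 0

section Action

variable {𝕜 : Type*} [RCLike 𝕜] {E : Type*} [NormedAddCommGroup E] [NormedSpace 𝕜 E]
  {D : Type*} [TopologicalSpace D] [ChartedSpace E D] [Group D]
  {X : Type*} [TopologicalSpace X]

variable (𝕜 E) in
/-- The functions on `D × X` that are regular near `(d, p)`: they are locally smooth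
(holomorphic) functions of the point of `D` and of finitely many regular functions on `X`. -/
def IsRegularOnProd [RegularFunctions 𝕜 X] (F : D × X → 𝕜) (d : D) (p : X) : Prop :=
  ∃ (m : ℕ) (h : Fin m → X → 𝕜) (Φ : D × (Fin m → 𝕜) → 𝕜),
    (∀ i, IsRegular (h i) p) ∧
    (∀ᶠ y in 𝓝 (d, fun i => h i p),
      ContMDiffAt (𝓘(𝕜, E).prod 𝓘(𝕜, Fin m → 𝕜)) 𝓘(𝕜, 𝕜) ∞ Φ y) ∧
    ∀ᶠ y in 𝓝 (d, p), F y = Φ (y.1, fun i => h i y.2)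

variable [LieGroup 𝓘(𝕜, E) ∞ D] [CompleteSpace E] {n : ℕ} {u u' : LieSubalgebra 𝕜 (GroupLieAlgebra 𝓘(𝕜, E) D)}

/-- The action of `(D, π^D)` on the Poisson space `X` is Poisson: the action map `D × X → X` is a
morphism of spaces with regular functions, and it is a Poisson map for the product Poisson
structure, `{F, G}(d, p) = {F(·, p), G(·, p)}_D(d) + {F(d, ·), G(d, ·)}_X(p)`, on `D × X`. -/
structure IsPoissonAction (x : Module.Basis (Fin n) 𝕜 u) (ξ : Module.Basis (Fin n) 𝕜 u')
    (X : Type*) [TopologicalSpace X] [PoissonSpace 𝕜 X] [MulAction D X] : Prop where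
  continuous : Continuous fun y : D × X => y.1 • y.2
  regular : ∀ (f : X → 𝕜) (d : D) (p : X), IsRegular f (d • p) →
    IsRegularOnProd 𝕜 E (fun y : D × X => f (y.1 • y.2)) d p
  bracket : ∀ (f g : X → 𝕜) (d : D) (p : X), IsRegular f (d • p) → IsRegular g (d • p) →
    PoissonSpace.bracket f g (d • p) =
      groupBracket x ξ (fun a => f (a • p)) (fun a => g (a • p)) d
        + PoissonSpace.bracket (fun q => f (d • q)) (fun q => g (d • q)) p

end Action

/-- The nonempty intersections of an `A`-orbit and an `A'`-orbit that are contained in `Y`. -/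
def orbitIntersections {D X : Type*} [Group D] [MulAction D X] (A A' : Subgroup D) (Y : Set X) :
    Set (Set X) :=
  {S | S.Nonempty ∧ S ⊆ Y ∧ ∃ y z : X, S = MulAction.orbit A y ∩ MulAction.orbit A' z}

end PoissonOrbits

/-!
Write `N = N(𝔲)`, `N' = N(𝔲')`, let `n(𝔲)` be the normalizer of `𝔲` in the Lie algebra, and let
`A`, `A'` be the connected subgroups with Lie algebras `n(𝔲) ∩ 𝔲'` and `n(𝔲') ∩ 𝔲`.  Since
`𝔲 ⊆ n(𝔲)` and `𝔡 = 𝔲 ⊕ 𝔲'`, one has `n(𝔲) = 𝔲 ⊕ (n(𝔲) ∩ 𝔲')`, so that a connected `N` equals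
`U A`, and similarly `N' = U' A'` (`exists_mul_eq_of_mem_normalizerSubgroup`).  Now `A` is contained
in `N ∩ U'`, and `A'` in `N' ∩ U`, while `N` normalizes `U` and `N'` normalizes `U'`.  If
`q = h a p = h' a' p` with `h ∈ U`, `a ∈ A`, `h' ∈ U'`, `a' ∈ A'`, then `a a'` lies in `N ∩ N'`, and
it carries `U p ∩ U' p` to `U a a' p ∩ U' a a' p = U a p ∩ U' a' p = U q ∩ U' q`
(`orbitIntersections_transitive`).

The equality `N = U A` amounts to the closed subgroup theorem for `N`, and is proved directly.
* In the chart at `1`, the mixed second derivative of the multiplication gives both the Lie bracket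
  and the differential of `Ad` at `1`, which is therefore `ad` (`hasStrictFDerivAt_AdL`).
* Every tangent vector at `1` is the velocity of a one-parameter subgroup over `𝕜`
  (`exists_isOneParameterSubgroup`).  Over `ℝ` it is an integral curve of a left invariant field;
  over `ℂ` it is `γ(z) = γ₁(re z) γ₂(im z)`, where `γ₁` and `γ₂` are the commuting real
  one-parameter subgroups with velocities `X` and `I X`.
* Along a one-parameter subgroup `Ad` is the exponential of `ad`, so that exponentials of `n(𝔲)` lie
  in `N` (`connectedSubgroup_le_normalizerSubgroup`).
* By the inverse function theorem, an element near `1` is a product of an element of `U`, an element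
  of `A`, and the point whose coordinate differs from that of `1` by some `Z` in a complement of
  `n(𝔲)`.  As `ad` restricted to this complement is injective modulo the operators that preserve
  `𝔲`, the last factor lies in `N` only if `Z = 0`
  (`eventually_mem_sup_of_mem_normalizerSubgroup`).
-/

namespace PoissonOrbits

/-! ### The multiplication in the chart at `1` -/

section Coordinates

variable (𝕜 : Type*) [RCLike 𝕜] (E : Type*) [NormedAddCommGroup E] [NormedSpace 𝕜 E]
  (D : Type*) [TopologicalSpace D] [ChartedSpace E D] [Group D]

/-- The multiplication of `D`, read in the preferred chart at `1`. -/
noncomputable def chartMul (p : E × E) : E :=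
  extChartAt 𝓘(𝕜, E) (1 : D)
    ((extChartAt 𝓘(𝕜, E) (1 : D)).symm p.1 * (extChartAt 𝓘(𝕜, E) (1 : D)).symm p.2)

/-- The coordinate of `1` in the preferred chart at `1`. -/
noncomputable def chartOne : E := extChartAt 𝓘(𝕜, E) (1 : D) 1

/-- The derivative at `1` of the left translation by the point with coordinate `a`, read in the
chart at `1`. -/
noncomputable def leftDeriv (a : E) : E →L[𝕜] E :=
  (fderiv 𝕜 (chartMul 𝕜 E D) (a, chartOne 𝕜 E D)).comp (ContinuousLinearMap.inr 𝕜 E E)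

/-- The derivative at `1` of the right translation by the point with coordinate `a`, read in the
chart at `1`. -/
noncomputable def rightDeriv (a : E) : E →L[𝕜] E :=
  (fderiv 𝕜 (chartMul 𝕜 E D) (chartOne 𝕜 E D, a)).comp (ContinuousLinearMap.inl 𝕜 E E)

variable {D} in
/-- The adjoint action as a continuous linear map on the model space `E`. -/
noncomputable def AdL (g : D) : E →L[𝕜] E :=
  (mfderiv 𝓘(𝕜, E) 𝓘(𝕜, E) (fun h : D => g * h * g⁻¹) (1 : D) : E →L[𝕜] E)

theorem chartOne_symm : (extChartAt 𝓘(𝕜, E) (1 : D)).symm (chartOne 𝕜 E D) = 1 :=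
  extChartAt_to_inv (I := 𝓘(𝕜, E)) (1 : D)

theorem target_mem_nhds_chartOne :
    (extChartAt 𝓘(𝕜, E) (1 : D)).target ∈ 𝓝 (chartOne 𝕜 E D) :=
  extChartAt_target_mem_nhds (I := 𝓘(𝕜, E)) (1 : D)

theorem tendsto_chart_symm :
    Tendsto (extChartAt 𝓘(𝕜, E) (1 : D)).symm (𝓝 (chartOne 𝕜 E D)) (𝓝 1) := by
  have := continuousAt_extChartAt_symm (I := 𝓘(𝕜, E)) (1 : D)
  rw [ContinuousAt, extChartAt_to_inv] at this
  exact this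

theorem tendsto_chart : Tendsto (extChartAt 𝓘(𝕜, E) (1 : D)) (𝓝 1) (𝓝 (chartOne 𝕜 E D)) :=
  continuousAt_extChartAt (I := 𝓘(𝕜, E)) (1 : D)

theorem eventually_chart_symm_chart :
    ∀ᶠ g in 𝓝 (1 : D), (extChartAt 𝓘(𝕜, E) (1 : D)).symm (extChartAt 𝓘(𝕜, E) (1 : D) g) = g := by
  filter_upwards [extChartAt_source_mem_nhds (I := 𝓘(𝕜, E)) (1 : D)] with g hg
  exact (extChartAt 𝓘(𝕜, E) (1 : D)).left_inv hg

theorem eventually_chart_chart_symm :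
    ∀ᶠ a in 𝓝 (chartOne 𝕜 E D),
      extChartAt 𝓘(𝕜, E) (1 : D) ((extChartAt 𝓘(𝕜, E) (1 : D)).symm a) = a := by
  filter_upwards [target_mem_nhds_chartOne 𝕜 E D] with a ha
  exact (extChartAt 𝓘(𝕜, E) (1 : D)).right_inv ha

theorem chartMul_one_right : ∀ᶠ a in 𝓝 (chartOne 𝕜 E D),
    chartMul 𝕜 E D (a, chartOne 𝕜 E D) = a := by
  filter_upwards [eventually_chart_chart_symm 𝕜 E D] with a ha
  simpa only [chartMul, chartOne_symm, mul_one] using ha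

theorem chartMul_one_left : ∀ᶠ a in 𝓝 (chartOne 𝕜 E D),
    chartMul 𝕜 E D (chartOne 𝕜 E D, a) = a := by
  filter_upwards [eventually_chart_chart_symm 𝕜 E D] with a ha
  simpa only [chartMul, chartOne_symm, one_mul] using ha

variable [LieGroup 𝓘(𝕜, E) ∞ D]

theorem contMDiffAt_chart_symm :
    ContMDiffAt 𝓘(𝕜, E) 𝓘(𝕜, E) ∞ (extChartAt 𝓘(𝕜, E) (1 : D)).symm (chartOne 𝕜 E D) :=
  (contMDiffOn_extChartAt_symm (I := 𝓘(𝕜, E)) (n := ∞) (1 : D)).contMDiffAt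
    (target_mem_nhds_chartOne 𝕜 E D)

theorem contDiffAt_chartMul :
    ContDiffAt 𝕜 ∞ (chartMul 𝕜 E D) (chartOne 𝕜 E D, chartOne 𝕜 E D) := by
  rw [← contMDiffAt_iff_contDiffAt]
  have h1 : ContMDiffAt 𝓘(𝕜, E × E) 𝓘(𝕜, E) ∞
      (fun p : E × E => (extChartAt 𝓘(𝕜, E) (1 : D)).symm p.1)
      (chartOne 𝕜 E D, chartOne 𝕜 E D) :=
    ContMDiffAt.comp (I' := 𝓘(𝕜, E)) _ (contMDiffAt_chart_symm 𝕜 E D)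
      contDiff_fst.contMDiff.contMDiffAt
  have h2 : ContMDiffAt 𝓘(𝕜, E × E) 𝓘(𝕜, E) ∞
      (fun p : E × E => (extChartAt 𝓘(𝕜, E) (1 : D)).symm p.2)
      (chartOne 𝕜 E D, chartOne 𝕜 E D) :=
    ContMDiffAt.comp (I' := 𝓘(𝕜, E)) _ (contMDiffAt_chart_symm 𝕜 E D)
      contDiff_snd.contMDiff.contMDiffAt
  refine ContMDiffAt.comp (I' := 𝓘(𝕜, E)) _ ?_ (h1.mul h2)
  simp only [chartOne_symm, mul_one]
  exact contMDiffAt_extChartAt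

theorem eventually_differentiableAt_chartMul :
    ∀ᶠ p in 𝓝 (chartOne 𝕜 E D, chartOne 𝕜 E D), DifferentiableAt 𝕜 (chartMul 𝕜 E D) p := by
  have := ((contDiffAt_chartMul 𝕜 E D).of_le (m := 1) (by exact_mod_cast le_top)).eventually
    (by simp)
  filter_upwards [this] with p hp
  exact hp.differentiableAt (by simp)

theorem hasFDerivAt_chartMul_right : ∀ᶠ a in 𝓝 (chartOne 𝕜 E D),
    HasFDerivAt (fun b => chartMul 𝕜 E D (a, b)) (leftDeriv 𝕜 E D a) (chartOne 𝕜 E D) := by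
  have ht : Tendsto (fun a : E => (a, chartOne 𝕜 E D)) (𝓝 (chartOne 𝕜 E D))
      (𝓝 (chartOne 𝕜 E D, chartOne 𝕜 E D)) := Continuous.tendsto (by fun_prop) _
  filter_upwards [ht.eventually (eventually_differentiableAt_chartMul 𝕜 E D)] with a ha
  exact ha.hasFDerivAt.comp _ (hasFDerivAt_prodMk_right a _)

theorem hasFDerivAt_chartMul_left : ∀ᶠ a in 𝓝 (chartOne 𝕜 E D),
    HasFDerivAt (fun b => chartMul 𝕜 E D (b, a)) (rightDeriv 𝕜 E D a) (chartOne 𝕜 E D) := by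
  have ht : Tendsto (fun a : E => (chartOne 𝕜 E D, a)) (𝓝 (chartOne 𝕜 E D))
      (𝓝 (chartOne 𝕜 E D, chartOne 𝕜 E D)) := Continuous.tendsto (by fun_prop) _
  filter_upwards [ht.eventually (eventually_differentiableAt_chartMul 𝕜 E D)] with a ha
  exact HasFDerivAt.comp (g := chartMul 𝕜 E D) (f := fun b => (b, a)) _ ha.hasFDerivAt
    (hasFDerivAt_prodMk_left _ _)

theorem leftDeriv_chartOne :
    leftDeriv 𝕜 E D (chartOne 𝕜 E D) = ContinuousLinearMap.id 𝕜 E :=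
  (hasFDerivAt_chartMul_right 𝕜 E D).self_of_nhds.unique
    ((hasFDerivAt_id _).congr_of_eventuallyEq (chartMul_one_left 𝕜 E D))

theorem rightDeriv_chartOne :
    rightDeriv 𝕜 E D (chartOne 𝕜 E D) = ContinuousLinearMap.id 𝕜 E :=
  (hasFDerivAt_chartMul_left 𝕜 E D).self_of_nhds.unique
    ((hasFDerivAt_id _).congr_of_eventuallyEq (chartMul_one_right 𝕜 E D))

theorem hasStrictFDerivAt_chartMul_one : HasStrictFDerivAt (chartMul 𝕜 E D)
    (ContinuousLinearMap.fst 𝕜 E E + ContinuousLinearMap.snd 𝕜 E E)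
    (chartOne 𝕜 E D, chartOne 𝕜 E D) := by
  have h := (contDiffAt_chartMul 𝕜 E D).hasStrictFDerivAt (by simp)
  have e : fderiv 𝕜 (chartMul 𝕜 E D) (chartOne 𝕜 E D, chartOne 𝕜 E D) =
      ContinuousLinearMap.fst 𝕜 E E + ContinuousLinearMap.snd 𝕜 E E := by
    refine ContinuousLinearMap.prod_ext ?_ ?_
    · exact (rightDeriv_chartOne 𝕜 E D).trans (by ext; simp)
    · exact (leftDeriv_chartOne 𝕜 E D).trans (by ext; simp)
  rwa [e] at h

theorem contDiffAt_leftDeriv : ContDiffAt 𝕜 2 (leftDeriv 𝕜 E D) (chartOne 𝕜 E D) := by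
  have h : ContDiffAt 𝕜 2 (fderiv 𝕜 (chartMul 𝕜 E D)) (chartOne 𝕜 E D, chartOne 𝕜 E D) :=
    (contDiffAt_chartMul 𝕜 E D).fderiv_right (by norm_cast)
  have h2 : ContDiffAt 𝕜 2 (fun a => fderiv 𝕜 (chartMul 𝕜 E D) (a, chartOne 𝕜 E D))
    (chartOne 𝕜 E D) := ContDiffAt.comp (f := fun a => (a, chartOne 𝕜 E D)) _ h (by fun_prop)
  exact h2.clm_comp contDiffAt_const

theorem contDiffAt_rightDeriv : ContDiffAt 𝕜 2 (rightDeriv 𝕜 E D) (chartOne 𝕜 E D) := by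
  have h : ContDiffAt 𝕜 2 (fderiv 𝕜 (chartMul 𝕜 E D)) (chartOne 𝕜 E D, chartOne 𝕜 E D) :=
    (contDiffAt_chartMul 𝕜 E D).fderiv_right (by norm_cast)
  have h2 : ContDiffAt 𝕜 2 (fun a => fderiv 𝕜 (chartMul 𝕜 E D) (chartOne 𝕜 E D, a))
    (chartOne 𝕜 E D) := ContDiffAt.comp (f := fun a => (chartOne 𝕜 E D, a)) _ h (by fun_prop)
  exact h2.clm_comp contDiffAt_const

/-- The mixed second derivatives of the multiplication agree. -/
theorem fderiv_rightDeriv_apply (v w : E) :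
    fderiv 𝕜 (rightDeriv 𝕜 E D) (chartOne 𝕜 E D) v w =
      fderiv 𝕜 (leftDeriv 𝕜 E D) (chartOne 𝕜 E D) w v := by
  have h : ContDiffAt 𝕜 1 (fderiv 𝕜 (chartMul 𝕜 E D)) (chartOne 𝕜 E D, chartOne 𝕜 E D) :=
    (contDiffAt_chartMul 𝕜 E D).fderiv_right (by norm_cast)
  have h' := (h.differentiableAt (by simp)).hasFDerivAt
  have hl : HasFDerivAt (leftDeriv 𝕜 E D) _ (chartOne 𝕜 E D) :=
    (HasFDerivAt.comp (f := fun a : E => (a, chartOne 𝕜 E D)) _ h'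
      (hasFDerivAt_prodMk_left _ _)).clm_comp (hasFDerivAt_const _ _)
  have hr : HasFDerivAt (rightDeriv 𝕜 E D) _ (chartOne 𝕜 E D) :=
    (HasFDerivAt.comp (f := fun a : E => (chartOne 𝕜 E D, a)) _ h'
      (hasFDerivAt_prodMk_right _ _)).clm_comp (hasFDerivAt_const _ _)
  rw [hl.fderiv, hr.fderiv]
  have hs := (contDiffAt_chartMul 𝕜 E D).isSymmSndFDerivAt
    (by rw [minSmoothness_of_isRCLikeNormedField]; exact ENat.LEInfty.out)
  simpa using hs.eq (0, v) (w, 0)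

end Coordinates

/-! ### The adjoint action and its differential -/

section Adjoint

variable {𝕜 : Type*} [RCLike 𝕜] {E : Type*} [NormedAddCommGroup E] [NormedSpace 𝕜 E]
  {D : Type*} [TopologicalSpace D] [ChartedSpace E D] [Group D]

/-- A manifold derivative at `1` is the derivative in the chart at `1`, since the tangent space at `1`
is the model space, identified by this very chart. -/
theorem hasFDerivAt_comp_chart_symm {F : Type*} [NormedAddCommGroup F] [NormedSpace 𝕜 F]
    {f : D → F} {L : E →L[𝕜] F} (h : HasMFDerivAt 𝓘(𝕜, E) 𝓘(𝕜, F) f (1 : D) L) :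
    HasFDerivAt (fun a => f ((extChartAt 𝓘(𝕜, E) (1 : D)).symm a)) L (chartOne 𝕜 E D) := by
  have h2 : HasFDerivWithinAt (fun a => f ((extChartAt 𝓘(𝕜, E) (1 : D)).symm a)) L
      (Set.range 𝓘(𝕜, E)) (chartOne 𝕜 E D) := h.2
  rwa [modelWithCornersSelf_coe, Set.range_id, hasFDerivWithinAt_univ] at h2

variable [LieGroup 𝓘(𝕜, E) ∞ D]

/-- The chart at `1` has the identity as its derivative at `1`. The point is allowed to equal `1` only
propositionally, as does `g * 1 * g⁻¹`. -/
theorem hasMFDerivAt_chart {g : D} (hg : g = 1) :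
    HasMFDerivAt 𝓘(𝕜, E) 𝓘(𝕜, E) (extChartAt 𝓘(𝕜, E) (1 : D)) g
      (ContinuousLinearMap.id 𝕜 E : E →L[𝕜] E) := by
  subst hg
  have : IsManifold 𝓘(𝕜, E) 1 D := IsManifold.of_le (n := ∞) ENat.LEInfty.out
  have h := (mdifferentiableAt_extChartAt (I := 𝓘(𝕜, E))
    (ChartedSpace.mem_chart_source (H := E) (1 : D))).hasMFDerivAt
  rwa [mfderiv_extChartAt_self] at h

theorem hasFDerivAt_conj (g : D) :
    HasFDerivAt (fun a => extChartAt 𝓘(𝕜, E) (1 : D)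
      (g * (extChartAt 𝓘(𝕜, E) (1 : D)).symm a * g⁻¹)) (AdL 𝕜 E g) (chartOne 𝕜 E D) := by
  have h := (hasMFDerivAt_chart (𝕜 := 𝕜) (E := E) (g := g * 1 * g⁻¹) (by simp)).comp (1 : D)
    (mdifferentiable_conj (𝕜 := 𝕜) (E := E) g 1).hasMFDerivAt
  exact hasFDerivAt_comp_chart_symm h

omit [LieGroup 𝓘(𝕜, E) ∞ D] in
theorem AdL_one : AdL 𝕜 E (1 : D) = ContinuousLinearMap.id 𝕜 E := by
  ext v
  exact DFunLike.congr_fun (Ad_one (𝕜 := 𝕜) (E := E) (D := D)) v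

theorem AdL_mul (g h : D) : AdL 𝕜 E (g * h) = AdL 𝕜 E g * AdL 𝕜 E h := by
  ext v
  exact DFunLike.congr_fun (Ad_mul (𝕜 := 𝕜) (E := E) g h) v

/-- The differential of `g h = (g h g⁻¹) g`. -/
theorem leftDeriv_eq_rightDeriv_mul_AdL : ∀ᶠ a in 𝓝 (chartOne 𝕜 E D),
    leftDeriv 𝕜 E D a =
      rightDeriv 𝕜 E D a * AdL 𝕜 E ((extChartAt 𝓘(𝕜, E) (1 : D)).symm a) := by
  have := continuousMul_of_contMDiffMul 𝓘(𝕜, E) ∞ (G := D)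
  filter_upwards [hasFDerivAt_chartMul_right 𝕜 E D, hasFDerivAt_chartMul_left 𝕜 E D] with a hl hr
  set g := (extChartAt 𝓘(𝕜, E) (1 : D)).symm a with hg
  have hc := hasFDerivAt_conj (𝕜 := 𝕜) (E := E) g
  have hr' : HasFDerivAt (fun b => chartMul 𝕜 E D (b, a)) (rightDeriv 𝕜 E D a)
      (extChartAt 𝓘(𝕜, E) (1 : D)
        (g * (extChartAt 𝓘(𝕜, E) (1 : D)).symm (chartOne 𝕜 E D) * g⁻¹)) := by
    simp only [chartOne_symm, mul_one, mul_inv_cancel]; exact hr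
  refine hl.unique ((HasFDerivAt.comp (f := fun a => extChartAt 𝓘(𝕜, E) (1 : D)
      (g * (extChartAt 𝓘(𝕜, E) (1 : D)).symm a * g⁻¹)) _ hr' hc).congr_of_eventuallyEq ?_)
  have ht : Tendsto (fun b => g * (extChartAt 𝓘(𝕜, E) (1 : D)).symm b * g⁻¹)
      (𝓝 (chartOne 𝕜 E D)) (𝓝 1) := by
    have := ((tendsto_chart_symm 𝕜 E D).const_mul g).mul_const g⁻¹
    simpa using this
  filter_upwards [ht.eventually (eventually_chart_symm_chart 𝕜 E D)] with b hb
  simp only [chartMul, Function.comp_apply]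
  rw [hb, ← hg, inv_mul_cancel_right]

variable [CompleteSpace E]

/-- `Ad` is smooth near `1`, because `leftDeriv = rightDeriv * Ad`, where `rightDeriv` is the identity
at `1` and hence invertible nearby. -/
theorem contDiffAt_AdL :
    ContDiffAt 𝕜 2 (fun a => AdL 𝕜 E ((extChartAt 𝓘(𝕜, E) (1 : D)).symm a))
      (chartOne 𝕜 E D) := by
  have hR := contDiffAt_rightDeriv 𝕜 E D
  have h1 : rightDeriv 𝕜 E D (chartOne 𝕜 E D) = (ContinuousLinearEquiv.refl 𝕜 E : E →L[𝕜] E) :=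
    rightDeriv_chartOne 𝕜 E D
  have hinv : ContDiffAt 𝕜 2 (fun a => (rightDeriv 𝕜 E D a).inverse) (chartOne 𝕜 E D) := by
    refine ContDiffAt.comp (g := ContinuousLinearMap.inverse) _ ?_ hR
    rw [h1]
    exact contDiffAt_map_inverse _
  refine (hinv.clm_comp (contDiffAt_leftDeriv 𝕜 E D)).congr_of_eventuallyEq ?_
  have hev : ∀ᶠ a in 𝓝 (chartOne 𝕜 E D), (rightDeriv 𝕜 E D a).IsInvertible := by
    refine hR.continuousAt.eventually (p := fun L => L.IsInvertible) ?_
    rw [h1]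
    exact ContinuousLinearEquiv.nhds (ContinuousLinearEquiv.refl 𝕜 E)
  filter_upwards [hev, leftDeriv_eq_rightDeriv_mul_AdL (𝕜 := 𝕜) (E := E) (D := D)] with a ha h
  rw [h, ContinuousLinearMap.mul_def, ← ContinuousLinearMap.comp_assoc, ha.inverse_comp_self,
    ContinuousLinearMap.id_comp]

/-- The differential of `Ad` at `1`, obtained by differentiating `leftDeriv = rightDeriv * Ad`. -/
theorem fderiv_AdL_apply (v w : E) :
    fderiv 𝕜 (fun a => AdL 𝕜 E ((extChartAt 𝓘(𝕜, E) (1 : D)).symm a)) (chartOne 𝕜 E D) v w =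
      fderiv 𝕜 (leftDeriv 𝕜 E D) (chartOne 𝕜 E D) v w
        - fderiv 𝕜 (leftDeriv 𝕜 E D) (chartOne 𝕜 E D) w v := by
  have hA := ((contDiffAt_AdL (𝕜 := 𝕜) (E := E) (D := D)).differentiableAt (by simp)).hasFDerivAt
  have hR := ((contDiffAt_rightDeriv 𝕜 E D).differentiableAt (by simp)).hasFDerivAt
  have h := (hR.clm_comp hA).congr_of_eventuallyEq
    (leftDeriv_eq_rightDeriv_mul_AdL (𝕜 := 𝕜) (E := E) (D := D))
  have h2 := DFunLike.congr_fun (DFunLike.congr_fun h.fderiv v) w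
  simp only [chartOne_symm, rightDeriv_chartOne, AdL_one] at h2
  rw [h2]
  simp [fderiv_rightDeriv_apply]

omit [CompleteSpace E] in
/-- In the chart at `1`, the left invariant field with value `v` at `1` is `a ↦ leftDeriv a v`. -/
theorem mpullback_mulInvariantVectorField_chart (v : GroupLieAlgebra 𝓘(𝕜, E) D) :
    ∀ᶠ a in 𝓝 (chartOne 𝕜 E D),
      VectorField.mpullbackWithin 𝓘(𝕜, E) 𝓘(𝕜, E) (extChartAt 𝓘(𝕜, E) (1 : D)).symm
        (mulInvariantVectorField (I := 𝓘(𝕜, E)) v) (Set.range 𝓘(𝕜, E)) a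
        = leftDeriv 𝕜 E D a v := by
  have : IsManifold 𝓘(𝕜, E) 1 D := IsManifold.of_le (n := ∞) ENat.LEInfty.out
  filter_upwards [hasFDerivAt_chartMul_right 𝕜 E D, target_mem_nhds_chartOne 𝕜 E D] with a hl ha
  set g := (extChartAt 𝓘(𝕜, E) (1 : D)).symm a with hg
  have hgs : g ∈ (extChartAt 𝓘(𝕜, E) (1 : D)).source := (extChartAt 𝓘(𝕜, E) (1 : D)).map_target ha
  have hκ : HasMFDerivAt 𝓘(𝕜, E) 𝓘(𝕜, E) (extChartAt 𝓘(𝕜, E) (1 : D)) (g * 1)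
      (mfderiv 𝓘(𝕜, E) 𝓘(𝕜, E) (extChartAt 𝓘(𝕜, E) (1 : D)) g : E →L[𝕜] E) := by
    rw [mul_one]
    exact (mdifferentiableAt_extChartAt (by rwa [extChartAt_source] at hgs)).hasMFDerivAt
  have hm : HasMFDerivAt 𝓘(𝕜, E) 𝓘(𝕜, E) (fun h : D => g * h) 1
      (mfderiv 𝓘(𝕜, E) 𝓘(𝕜, E) (fun h : D => g * h) 1) :=
    ((contMDiff_mul_left (I := 𝓘(𝕜, E)) (n := ∞) (a := g)).mdifferentiable
      (by simp) 1).hasMFDerivAt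
  have key := hl.unique (hasFDerivAt_comp_chart_symm (hκ.comp (1 : D) hm))
  rw [key, VectorField.mpullbackWithin_apply]
  have hinv : (mfderivWithin 𝓘(𝕜, E) 𝓘(𝕜, E) (extChartAt 𝓘(𝕜, E) (1 : D)).symm
      (Set.range 𝓘(𝕜, E)) a).inverse
        = mfderiv 𝓘(𝕜, E) 𝓘(𝕜, E) (extChartAt 𝓘(𝕜, E) (1 : D)) g :=
    ContinuousLinearMap.inverse_eq (mfderivWithin_extChartAt_symm_comp_mfderiv_extChartAt ha)
      (mfderiv_extChartAt_comp_mfderivWithin_extChartAt_symm ha)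
  rw [hinv]
  rfl

omit [CompleteSpace E] in
theorem bracket_eq_fderiv_leftDeriv (v w : GroupLieAlgebra 𝓘(𝕜, E) D) :
    (⁅v, w⁆ : GroupLieAlgebra 𝓘(𝕜, E) D) =
      fderiv 𝕜 (leftDeriv 𝕜 E D) (chartOne 𝕜 E D) v w
        - fderiv 𝕜 (leftDeriv 𝕜 E D) (chartOne 𝕜 E D) w v := by
  have : IsManifold 𝓘(𝕜, E) 1 D := IsManifold.of_le (n := ∞) ENat.LEInfty.out
  have hL := ((contDiffAt_leftDeriv 𝕜 E D).differentiableAt (by simp)).hasFDerivAt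
  have hd : ∀ x : E, HasFDerivAt (fun a => leftDeriv 𝕜 E D a x)
      ((fderiv 𝕜 (leftDeriv 𝕜 E D) (chartOne 𝕜 E D)).flip x) (chartOne 𝕜 E D) := by
    intro x
    exact (hL.clm_apply (hasFDerivAt_const x _)).congr_fderiv (by ext; simp)
  let P (x : GroupLieAlgebra 𝓘(𝕜, E) D) : E → E :=
    VectorField.mpullbackWithin 𝓘(𝕜, E) 𝓘(𝕜, E) (extChartAt 𝓘(𝕜, E) (1 : D)).symm
      (mulInvariantVectorField (I := 𝓘(𝕜, E)) x) (Set.range 𝓘(𝕜, E))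
  let M : E →L[𝕜] E := mfderiv 𝓘(𝕜, E) 𝓘(𝕜, E) (extChartAt 𝓘(𝕜, E) (1 : D)) (1 : D)
  have h0 : (⁅v, w⁆ : GroupLieAlgebra 𝓘(𝕜, E) D) =
      M.inverse
        (VectorField.lieBracketWithin 𝕜 (P v) (P w)
          ((extChartAt 𝓘(𝕜, E) (1 : D)).symm ⁻¹' Set.univ ∩ Set.range 𝓘(𝕜, E))
          (chartOne 𝕜 E D)) := rfl
  have hM : M = ContinuousLinearMap.id 𝕜 E := mfderiv_extChartAt_self
  have hset : (extChartAt 𝓘(𝕜, E) (1 : D)).symm ⁻¹' Set.univ ∩ Set.range 𝓘(𝕜, E) = Set.univ := by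
    simp
  have hP (x : GroupLieAlgebra 𝓘(𝕜, E) D) :
      P x =ᶠ[𝓝 (chartOne 𝕜 E D)] fun a => leftDeriv 𝕜 E D a x :=
    mpullback_mulInvariantVectorField_chart x
  have hb := (hP v).lieBracket_vectorField_eq (𝕜 := 𝕜) (hP w)
  have hb2 : VectorField.lieBracket 𝕜 (fun a => leftDeriv 𝕜 E D a v)
      (fun a => leftDeriv 𝕜 E D a w) (chartOne 𝕜 E D) =
      fderiv 𝕜 (leftDeriv 𝕜 E D) (chartOne 𝕜 E D) v w
        - fderiv 𝕜 (leftDeriv 𝕜 E D) (chartOne 𝕜 E D) w v := by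
    rw [VectorField.lieBracket_eq]
    simp only [(hd v).fderiv, (hd w).fderiv, leftDeriv_chartOne]
    rfl
  rw [h0, hM, hset, VectorField.lieBracketWithin_univ, hb, ← hb2, ContinuousLinearMap.inverse_id]
  rfl

/-- The differential of `Ad` at `1` is `ad`. -/
theorem hasStrictFDerivAt_AdL :
    ∃ T : E →L[𝕜] E →L[𝕜] E,
      (∀ v w : GroupLieAlgebra 𝓘(𝕜, E) D, T v w = (⁅v, w⁆ : GroupLieAlgebra 𝓘(𝕜, E) D)) ∧
      HasStrictFDerivAt (fun a => AdL 𝕜 E ((extChartAt 𝓘(𝕜, E) (1 : D)).symm a)) T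
        (chartOne 𝕜 E D) :=
  ⟨_, fun v w => (fderiv_AdL_apply (𝕜 := 𝕜) (E := E) (D := D) v w).trans (bracket_eq_fderiv_leftDeriv v w).symm,
    contDiffAt_AdL.hasStrictFDerivAt (by simp)⟩

end Adjoint

/-! ### One-parameter subgroups over `ℝ` or `ℂ` -/

section OneParameter

variable (𝕜 : Type*) [RCLike 𝕜] {E : Type*} [NormedAddCommGroup E] [NormedSpace 𝕜 E]
  {D : Type*} [TopologicalSpace D] [ChartedSpace E D] [Group D]

/-- `γ` is a one-parameter subgroup of `D` with `γ'(0) = X`. -/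
structure IsOneParameterSubgroup (γ : 𝕜 → D) (X : E) : Prop where
  map_add : ∀ s t, γ (s + t) = γ s * γ t
  hasMFDerivAt : HasMFDerivAt 𝓘(𝕜, 𝕜) 𝓘(𝕜, E) γ 0
    ((1 : 𝕜 →L[𝕜] 𝕜).smulRight X : 𝕜 →L[𝕜] E)

variable {𝕜}

theorem comp_one_smulRight (L : E →L[𝕜] E) (v : E) :
    L.comp ((1 : 𝕜 →L[𝕜] 𝕜).smulRight v) = (1 : 𝕜 →L[𝕜] 𝕜).smulRight (L v) := by
  ext; simp

theorem hasMFDerivAt_iff_chart {V : Type*} [NormedAddCommGroup V] [NormedSpace 𝕜 V]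
    {f : V → D} {v : V} (hf : f v = 1) {L : V →L[𝕜] E} :
    HasMFDerivAt 𝓘(𝕜, V) 𝓘(𝕜, E) f v L ↔
      ContinuousAt f v ∧ HasFDerivAt (fun x => extChartAt 𝓘(𝕜, E) (1 : D) (f x)) L v := by
  have h : HasMFDerivAt 𝓘(𝕜, V) 𝓘(𝕜, E) f v L ↔ ContinuousAt f v ∧
      HasFDerivWithinAt (fun x => extChartAt 𝓘(𝕜, E) (f v) (f x)) L (Set.range 𝓘(𝕜, V)) v :=
    Iff.rfl
  rw [h, modelWithCornersSelf_coe, Set.range_id, hasFDerivWithinAt_univ, hf]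

namespace IsOneParameterSubgroup

variable {γ : 𝕜 → D} {X : E}

theorem map_zero (h : IsOneParameterSubgroup 𝕜 γ X) : γ 0 = 1 := by
  have := h.map_add 0 0
  rw [add_zero] at this
  exact left_eq_mul.mp this

theorem map_neg (h : IsOneParameterSubgroup 𝕜 γ X) (t : 𝕜) : γ (-t) = (γ t)⁻¹ := by
  rw [eq_inv_iff_mul_eq_one, ← h.map_add, neg_add_cancel, h.map_zero]

theorem continuousAt_zero (h : IsOneParameterSubgroup 𝕜 γ X) : ContinuousAt γ 0 :=
  h.hasMFDerivAt.1

theorem hasFDerivAt_chart (h : IsOneParameterSubgroup 𝕜 γ X) :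
    HasFDerivAt (fun t => extChartAt 𝓘(𝕜, E) (1 : D) (γ t))
      ((1 : 𝕜 →L[𝕜] 𝕜).smulRight X : 𝕜 →L[𝕜] E) 0 :=
  ((hasMFDerivAt_iff_chart h.map_zero).1 h.hasMFDerivAt).2

end IsOneParameterSubgroup

omit [Group D] in
theorem mfderiv_one_apply_eq_iff {γ : 𝕜 → D} {X : E}
    (h : MDifferentiableAt 𝓘(𝕜, 𝕜) 𝓘(𝕜, E) γ 0) :
    (mfderiv 𝓘(𝕜, 𝕜) 𝓘(𝕜, E) γ 0 : 𝕜 →L[𝕜] E) (1 : 𝕜) = X ↔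
      HasMFDerivAt 𝓘(𝕜, 𝕜) 𝓘(𝕜, E) γ 0 ((1 : 𝕜 →L[𝕜] 𝕜).smulRight X : 𝕜 →L[𝕜] E) := by
  have e : ((1 : 𝕜 →L[𝕜] 𝕜).smulRight X : 𝕜 →L[𝕜] E) (1 : 𝕜) = X := by simp
  constructor
  · intro hX
    have : (mfderiv 𝓘(𝕜, 𝕜) 𝓘(𝕜, E) γ 0 : 𝕜 →L[𝕜] E) = (1 : 𝕜 →L[𝕜] 𝕜).smulRight X := by
      exact ContinuousLinearMap.ext_ring (hX.trans e.symm)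
    exact this ▸ h.hasMFDerivAt
  · intro hX
    rw [hX.mfderiv]
    exact e

variable [LieGroup 𝓘(𝕜, E) ∞ D]

/-- The derivative of a left translation at a point `y` that equals `h` propositionally, with the
derivative written at `h`: this avoids casts between tangent spaces. -/
theorem hasMFDerivAt_mul_left {g h y : D} (hy : y = h) :
    HasMFDerivAt 𝓘(𝕜, E) 𝓘(𝕜, E) (fun x : D => g * x) y
      (mfderiv 𝓘(𝕜, E) 𝓘(𝕜, E) (fun x : D => g * x) h : E →L[𝕜] E) := by
  subst hy
  exact ((contMDiff_mul_left (I := 𝓘(𝕜, E)) (n := ∞) (a := g)).mdifferentiable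
      (by simp) y).hasMFDerivAt

/-- Left invariance of the invariant vector fields. -/
theorem mfderiv_mul_left_mulInvariantVectorField (g h : D) (X : GroupLieAlgebra 𝓘(𝕜, E) D) :
    (mfderiv 𝓘(𝕜, E) 𝓘(𝕜, E) (fun x : D => g * x) h : E →L[𝕜] E)
      (mulInvariantVectorField (I := 𝓘(𝕜, E)) X h) =
      mulInvariantVectorField (I := 𝓘(𝕜, E)) X (g * h) := by
  have h1 := (hasMFDerivAt_mul_left (𝕜 := 𝕜) (E := E) (g := g) (mul_one h)).comp (1 : D)
    (hasMFDerivAt_mul_left (𝕜 := 𝕜) (E := E) (g := h) rfl)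
  have h2 : ((fun x : D => g * x) ∘ fun x : D => h * x) = fun x : D => g * h * x := by
    ext x; simp [mul_assoc]
  rw [h2] at h1
  have h3 := h1.mfderiv
  unfold mulInvariantVectorField
  exact (DFunLike.congr_fun h3 X).symm

theorem IsOneParameterSubgroup.mdifferentiable {γ : 𝕜 → D} {X : E}
    (h : IsOneParameterSubgroup 𝕜 γ X) : MDifferentiable 𝓘(𝕜, 𝕜) 𝓘(𝕜, E) γ := by
  intro t
  have e : γ = (fun x : D => γ t * x) ∘ γ ∘ fun s => s - t := by
    ext s
    simp [← h.map_add]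
  have h1 : MDifferentiableAt 𝓘(𝕜, 𝕜) 𝓘(𝕜, 𝕜) (fun s : 𝕜 => s - t) t :=
    (differentiableAt_id.sub_const t).mdifferentiableAt
  have h2 : MDifferentiableAt 𝓘(𝕜, 𝕜) 𝓘(𝕜, E) γ (t - t) := by
    rw [sub_self]; exact h.hasMFDerivAt.mdifferentiableAt
  rw [e]
  exact MDifferentiableAt.comp (I' := 𝓘(𝕜, E)) t
    ((contMDiff_mul_left (I := 𝓘(𝕜, E)) (n := ∞) (a := γ t)).mdifferentiable (by simp) _)
    (MDifferentiableAt.comp (I' := 𝓘(𝕜, 𝕜)) t h2 h1)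

theorem IsOneParameterSubgroup.isExp {γ : 𝕜 → D} {X : E}
    (h : IsOneParameterSubgroup 𝕜 γ X) : IsExp (𝕜 := 𝕜) (E := E) (D := D) X (γ 1) :=
  ⟨γ, h.map_add, h.mdifferentiable,
    (mfderiv_one_apply_eq_iff h.hasMFDerivAt.mdifferentiableAt).2 h.hasMFDerivAt, rfl⟩

omit [LieGroup 𝓘(𝕜, E) ∞ D] in
theorem IsExp.exists_isOneParameterSubgroup {X : E} {g : D}
    (h : IsExp (𝕜 := 𝕜) (E := E) (D := D) X g) :
    ∃ γ : 𝕜 → D, IsOneParameterSubgroup 𝕜 γ X ∧ γ 1 = g := by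
  obtain ⟨γ, h1, h2, h3, h4⟩ := h
  exact ⟨γ, ⟨h1, (mfderiv_one_apply_eq_iff (h2 0)).1 h3⟩, h4⟩

/-- Conjugation by `g` turns a one-parameter subgroup with velocity `X` into one with
velocity `Ad g X`. -/
theorem IsOneParameterSubgroup.conj {γ : 𝕜 → D} {X : E} (h : IsOneParameterSubgroup 𝕜 γ X)
    (g : D) : IsOneParameterSubgroup 𝕜 (fun t => g * γ t * g⁻¹) (AdL 𝕜 E g X) := by
  refine ⟨fun s t => by simp [h.map_add, mul_assoc], ?_⟩
  have h1 := (mdifferentiable_conj (𝕜 := 𝕜) (E := E) g (γ 0)).hasMFDerivAt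
  have h2 := h1.comp (0 : 𝕜) h.hasMFDerivAt
  have h3 : (mfderiv 𝓘(𝕜, E) 𝓘(𝕜, E) (fun h : D => g * h * g⁻¹) (γ 0) : E →L[𝕜] E)
      = AdL 𝕜 E g := by rw [h.map_zero]; rfl
  have h4 : ((mfderiv 𝓘(𝕜, E) 𝓘(𝕜, E) (fun h : D => g * h * g⁻¹) (γ 0) : E →L[𝕜] E).comp
      ((1 : 𝕜 →L[𝕜] 𝕜).smulRight X : 𝕜 →L[𝕜] E)) =
      (1 : 𝕜 →L[𝕜] 𝕜).smulRight (AdL 𝕜 E g X) :=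
    (congrArg (fun L => L.comp ((1 : 𝕜 →L[𝕜] 𝕜).smulRight X : 𝕜 →L[𝕜] E)) h3).trans
      (comp_one_smulRight (E := E) _ _)
  exact h4 ▸ h2

/-- The coordinates of a one-parameter subgroup solve an autonomous differential equation, which
makes them continuously differentiable. -/
theorem IsOneParameterSubgroup.hasStrictFDerivAt_chart {γ : 𝕜 → D} {X : E}
    (h : IsOneParameterSubgroup 𝕜 γ X) :
    HasStrictFDerivAt (fun t => extChartAt 𝓘(𝕜, E) (1 : D) (γ t))
      ((1 : 𝕜 →L[𝕜] 𝕜).smulRight X : 𝕜 →L[𝕜] E) 0 := by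
  have hγ : Tendsto γ (𝓝 0) (𝓝 1) := by
    have := h.continuousAt_zero
    rwa [ContinuousAt, h.map_zero] at this
  have hc : Tendsto (fun t => extChartAt 𝓘(𝕜, E) (1 : D) (γ t)) (𝓝 0) (𝓝 (chartOne 𝕜 E D)) :=
    (tendsto_chart 𝕜 E D).comp hγ
  have hd : ∀ᶠ t in 𝓝 (0 : 𝕜), HasFDerivAt (fun t => extChartAt 𝓘(𝕜, E) (1 : D) (γ t))
      ((leftDeriv 𝕜 E D (extChartAt 𝓘(𝕜, E) (1 : D) (γ t))).comp
        ((1 : 𝕜 →L[𝕜] 𝕜).smulRight X : 𝕜 →L[𝕜] E)) t := by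
    filter_upwards [hc.eventually (hasFDerivAt_chartMul_right 𝕜 E D),
      hγ.eventually (eventually_chart_symm_chart 𝕜 E D)] with t ht ht'
    have h0 : HasFDerivAt (fun s => extChartAt 𝓘(𝕜, E) (1 : D) (γ (s - t)))
        ((1 : 𝕜 →L[𝕜] 𝕜).smulRight X : 𝕜 →L[𝕜] E) t := by
      have h1 := h.hasFDerivAt_chart
      rw [← sub_self t] at h1
      exact HasFDerivAt.comp (f := fun s => s - t) t h1 ((hasFDerivAt_id t).sub_const t)
    have ht1 : HasFDerivAt (fun b => chartMul 𝕜 E D (extChartAt 𝓘(𝕜, E) (1 : D) (γ t), b))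
        (leftDeriv 𝕜 E D (extChartAt 𝓘(𝕜, E) (1 : D) (γ t)))
        (extChartAt 𝓘(𝕜, E) (1 : D) (γ (t - t))) := by
      rw [sub_self, h.map_zero]; exact ht
    refine (HasFDerivAt.comp (f := fun s => extChartAt 𝓘(𝕜, E) (1 : D) (γ (s - t))) t ht1
      h0).congr_of_eventuallyEq ?_
    have hts : Tendsto (fun s => γ (s - t)) (𝓝 t) (𝓝 1) :=
      hγ.comp (by simpa using (continuous_sub_right t).tendsto t)
    filter_upwards [hts.eventually (eventually_chart_symm_chart 𝕜 E D)] with s hs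
    simp only [chartMul, Function.comp_apply]
    rw [hs, ht', ← h.map_add, add_sub_cancel]
  have hcont : ContinuousAt (fun t => (leftDeriv 𝕜 E D (extChartAt 𝓘(𝕜, E) (1 : D) (γ t))).comp
        ((1 : 𝕜 →L[𝕜] 𝕜).smulRight X : 𝕜 →L[𝕜] E)) 0 := by
    have h1 : ContinuousAt (fun t => leftDeriv 𝕜 E D (extChartAt 𝓘(𝕜, E) (1 : D) (γ t))) 0 := by
      have h2 : ContinuousAt (leftDeriv 𝕜 E D) (extChartAt 𝓘(𝕜, E) (1 : D) (γ 0)) := by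
        rw [h.map_zero]
        exact (contDiffAt_leftDeriv 𝕜 E D).continuousAt
      refine ContinuousAt.comp (f := fun t => extChartAt 𝓘(𝕜, E) (1 : D) (γ t)) h2 ?_
      rw [ContinuousAt, h.map_zero]
      exact hc
    exact h1.clm_comp continuousAt_const
  have hs := hasStrictFDerivAt_of_hasFDerivAt_of_continuousAt hd hcont
  rw [h.map_zero] at hs
  exact hs.congr_fderiv ((congrArg
    (fun L => L.comp ((1 : 𝕜 →L[𝕜] 𝕜).smulRight X : 𝕜 →L[𝕜] E)) (leftDeriv_chartOne 𝕜 E D)).trans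
    (ContinuousLinearMap.id_comp _))

end OneParameter

/-! ### Existence of one-parameter subgroups -/

/-- A locally Euclidean topological group is Hausdorff. This makes integral curves unique. -/
theorem t2Space_of_chartedSpace (H D : Type*) [TopologicalSpace H] [T1Space H] [TopologicalSpace D]
    [ChartedSpace H D] [Group D] [IsTopologicalGroup D] : T2Space D := by
  have := ChartedSpace.t1Space H D
  infer_instance

section RealCurves

variable {E : Type*} [NormedAddCommGroup E] [NormedSpace ℝ E]
  {D : Type*} [TopologicalSpace D] [ChartedSpace E D] [Group D] [LieGroup 𝓘(ℝ, E) ∞ D]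

theorem IsMIntegralCurveOn.mul_left {X : GroupLieAlgebra 𝓘(ℝ, E) D} {γ : ℝ → D} {s : Set ℝ}
    (h : IsMIntegralCurveOn (I := 𝓘(ℝ, E)) γ (mulInvariantVectorField X) s) (g : D) :
    IsMIntegralCurveOn (I := 𝓘(ℝ, E)) (fun t => g * γ t) (mulInvariantVectorField X) s := by
  intro t ht
  have h1 := (hasMFDerivAt_mul_left (𝕜 := ℝ) (E := E) (g := g) (y := γ t) rfl).comp_hasMFDerivWithinAt
    t (h t ht)
  have h2 : (mfderiv 𝓘(ℝ, E) 𝓘(ℝ, E) (fun x : D => g * x) (γ t) : E →L[ℝ] E).comp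
      ((1 : ℝ →L[ℝ] ℝ).smulRight (mulInvariantVectorField (I := 𝓘(ℝ, E)) X (γ t) : E) : ℝ →L[ℝ] E)
      = (1 : ℝ →L[ℝ] ℝ).smulRight (mulInvariantVectorField (I := 𝓘(ℝ, E)) X (g * γ t) : E) :=
    (comp_one_smulRight (E := E) _ _).trans (congrArg (fun v : E => (1 : ℝ →L[ℝ] ℝ).smulRight v)
      (mfderiv_mul_left_mulInvariantVectorField g (γ t) X))
  exact h2 ▸ h1

/-- A real one-parameter subgroup is an integral curve of a left invariant field. -/
theorem IsOneParameterSubgroup.isMIntegralCurve {X : E} {γ : ℝ → D}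
    (h : IsOneParameterSubgroup ℝ γ X) :
    IsMIntegralCurve (I := 𝓘(ℝ, E)) γ (mulInvariantVectorField (I := 𝓘(ℝ, E)) (G := D) X) := by
  intro t
  have e : γ = (fun x : D => γ t * x) ∘ γ ∘ fun s => s - t := by
    ext s
    simp [← h.map_add]
  have h1 : HasMFDerivAt 𝓘(ℝ, ℝ) 𝓘(ℝ, ℝ) (fun s : ℝ => s - t) t
      (ContinuousLinearMap.id ℝ ℝ : ℝ →L[ℝ] ℝ) :=
    ((hasFDerivAt_id t).sub_const t).hasMFDerivAt
  have h2 : HasMFDerivAt 𝓘(ℝ, ℝ) 𝓘(ℝ, E) γ (t - t)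
      ((1 : ℝ →L[ℝ] ℝ).smulRight X : ℝ →L[ℝ] E) := by
    rw [sub_self]; exact h.hasMFDerivAt
  have h3 := (hasMFDerivAt_mul_left (𝕜 := ℝ) (E := E) (g := γ t) (y := γ (t - t)) (h := 1)
    (by rw [sub_self, h.map_zero])).comp t (HasMFDerivAt.comp (f := fun s => s - t) t h2 h1)
  have h4 : (mfderiv 𝓘(ℝ, E) 𝓘(ℝ, E) (fun x : D => γ t * x) 1 : E →L[ℝ] E).comp
      (((1 : ℝ →L[ℝ] ℝ).smulRight X : ℝ →L[ℝ] E).comp (ContinuousLinearMap.id ℝ ℝ))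
      = (1 : ℝ →L[ℝ] ℝ).smulRight
        (mulInvariantVectorField (I := 𝓘(ℝ, E)) (G := D) X (γ t) : E) :=
    comp_one_smulRight (E := E) _ _
  have h5 := h4 ▸ h3
  rwa [← e] at h5

theorem contMDiff_one_mulInvariantVectorField (X : GroupLieAlgebra 𝓘(ℝ, E) D) :
    ContMDiff 𝓘(ℝ, E) 𝓘(ℝ, E).tangent 1
      (fun g : D => (⟨g, mulInvariantVectorField X g⟩ : TangentBundle 𝓘(ℝ, E) D)) := by
  refine (contMDiff_mulInvariantVectorField (I := 𝓘(ℝ, E)) X).of_le ?_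
  rw [minSmoothness_of_isRCLikeNormedField]
  norm_num

theorem IsOneParameterSubgroup.unique {X : E} {γ γ' : ℝ → D}
    (h : IsOneParameterSubgroup ℝ γ X) (h' : IsOneParameterSubgroup ℝ γ' X) : γ = γ' := by
  have := topologicalGroup_of_lieGroup 𝓘(ℝ, E) ∞ (G := D)
  have := t2Space_of_chartedSpace E D
  have : IsManifold 𝓘(ℝ, E) 1 D := IsManifold.of_le (n := ∞) ENat.LEInfty.out
  exact isMIntegralCurve_Ioo_eq_of_contMDiff_boundaryless (t₀ := 0)
    (contMDiff_one_mulInvariantVectorField X) h.isMIntegralCurve h'.isMIntegralCurve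
    (h.map_zero.trans h'.map_zero.symm)

/-- Every tangent vector at `1` is the velocity of a real one-parameter subgroup: the integral
curve through `1` of the left invariant vector field. Left translation shows that all integral
curves exist for the same length of time, hence for all times. -/
theorem exists_isOneParameterSubgroup_real [CompleteSpace E] (X : E) :
    ∃ γ : ℝ → D, IsOneParameterSubgroup ℝ γ X := by
  have := topologicalGroup_of_lieGroup 𝓘(ℝ, E) ∞ (G := D)
  have := t2Space_of_chartedSpace E D
  have : IsManifold 𝓘(ℝ, E) 1 D := IsManifold.of_le (n := ∞) ENat.LEInfty.out
  have hV := contMDiff_one_mulInvariantVectorField (E := E) (D := D) X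
  obtain ⟨γ₀, h0, hγ₀⟩ :=
    exists_isMIntegralCurveAt_of_contMDiffAt_boundaryless (0 : ℝ) (hV.contMDiffAt (x := 1))
  obtain ⟨ε, hε, hγ₀⟩ := isMIntegralCurveAt_iff'.1 hγ₀
  rw [Real.ball_eq_Ioo, zero_sub, zero_add] at hγ₀
  obtain ⟨γ, hγ0, hγ⟩ := exists_isMIntegralCurve_of_isMIntegralCurveOn hV hε
    (fun x => ⟨fun t => x * γ₀ t, by simp [h0], IsMIntegralCurveOn.mul_left hγ₀ x⟩) 1
  refine ⟨γ, fun s t => ?_, ?_⟩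
  · have h1 : IsMIntegralCurve (I := 𝓘(ℝ, E)) (fun t => γ s * γ t)
        (mulInvariantVectorField (I := 𝓘(ℝ, E)) (G := D) X) :=
      isMIntegralCurve_iff_isMIntegralCurveOn.2
        (IsMIntegralCurveOn.mul_left (isMIntegralCurve_iff_isMIntegralCurveOn.1 hγ) _)
    have h2 := isMIntegralCurve_Ioo_eq_of_contMDiff_boundaryless (t₀ := 0) hV (hγ.comp_add s) h1
      (by simp [hγ0])
    have := congrFun h2 t
    rw [add_comm]
    exact this
  · have h1 := hγ 0
    have h2 : (mulInvariantVectorField (I := 𝓘(ℝ, E)) (G := D) X (γ 0) : E) = X := by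
      rw [hγ0]
      have : (fun x : D => 1 * x) = id := by ext; simp
      unfold mulInvariantVectorField
      rw [this, mfderiv_id]
      rfl
    have h3 : ((1 : ℝ →L[ℝ] ℝ).smulRight
        (mulInvariantVectorField (I := 𝓘(ℝ, E)) (G := D) X (γ 0) : E) : ℝ →L[ℝ] E)
        = (1 : ℝ →L[ℝ] ℝ).smulRight X := by rw [h2]
    exact h3 ▸ h1

end RealCurves

section RestrictScalars

variable (𝕜 : Type*) [RCLike 𝕜] {E : Type*} [NormedAddCommGroup E] [NormedSpace 𝕜 E]
  [NormedSpace ℝ E] [IsScalarTower ℝ 𝕜 E]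
  {D : Type*} [TopologicalSpace D] [ChartedSpace E D]

theorem contMDiff_restrictScalars_of_prod {f : D × D → D}
    (h : ContMDiff (𝓘(𝕜, E).prod 𝓘(𝕜, E)) 𝓘(𝕜, E) ∞ f) :
    ContMDiff (𝓘(ℝ, E).prod 𝓘(ℝ, E)) 𝓘(ℝ, E) ∞ f := fun x =>
  ⟨(h x).1, (h x).2.restrict_scalars ℝ⟩

theorem contMDiff_restrictScalars {f : D → D} (h : ContMDiff 𝓘(𝕜, E) 𝓘(𝕜, E) ∞ f) :
    ContMDiff 𝓘(ℝ, E) 𝓘(ℝ, E) ∞ f := fun x =>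
  ⟨(h x).1, (h x).2.restrict_scalars ℝ⟩

theorem isManifold_restrictScalars [IsManifold 𝓘(𝕜, E) ∞ D] : IsManifold 𝓘(ℝ, E) ∞ D := by
  refine isManifold_of_contDiffOn _ _ _ fun e e' he he' => ?_
  have h := (contDiffGroupoid ∞ 𝓘(𝕜, E)).compatible he he'
  rw [contDiffGroupoid, mem_groupoid_of_pregroupoid] at h
  exact h.1.restrict_scalars ℝ

theorem lieGroup_restrictScalars [Group D] [LieGroup 𝓘(𝕜, E) ∞ D] : LieGroup 𝓘(ℝ, E) ∞ D :=
  { isManifold_restrictScalars 𝕜 with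
    contMDiff_mul := contMDiff_restrictScalars_of_prod 𝕜 (contMDiff_mul 𝓘(𝕜, E) ∞)
    contMDiff_inv := contMDiff_restrictScalars 𝕜 (contMDiff_inv 𝓘(𝕜, E) ∞) }

variable [Group D] [LieGroup 𝓘(𝕜, E) ∞ D] {X : E} {γ : ℝ → D}

/-- The adjoint action defined over `𝕜` describes the conjugation of real one-parameter subgroups:
it agrees with that of the underlying real Lie group. -/
theorem IsOneParameterSubgroup.conj_restrictScalars (h : IsOneParameterSubgroup ℝ γ X) (g : D) :
    IsOneParameterSubgroup ℝ (fun t => g * γ t * g⁻¹) (AdL 𝕜 E g X) := by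
  have := lieGroup_restrictScalars 𝕜 (E := E) (D := D)
  have e : AdL ℝ E g = (AdL 𝕜 E g).restrictScalars ℝ :=
    (hasFDerivAt_conj (𝕜 := ℝ) (E := E) g).unique
      ((hasFDerivAt_conj (𝕜 := 𝕜) (E := E) g).restrictScalars ℝ)
  have h2 := h.conj g
  rw [e] at h2
  exact h2

theorem IsOneParameterSubgroup.AdL_self (h : IsOneParameterSubgroup ℝ γ X) (s : ℝ) :
    AdL 𝕜 E (γ s) X = X := by
  have h1 := h.conj_restrictScalars 𝕜 (γ s)
  have e : (fun t => γ s * γ t * (γ s)⁻¹) = γ := by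
    ext t
    rw [← h.map_add, add_comm, h.map_add, mul_inv_cancel_right]
  rw [e] at h1
  have h2 := DFunLike.congr_fun (h1.hasFDerivAt_chart.unique h.hasFDerivAt_chart) (1 : ℝ)
  simpa using h2

/-- The one-parameter subgroup over `𝕜` with velocity `X` is assembled from the real one-parameter
subgroups with velocities `X` and `I X`, which commute because `Ad` is `𝕜`-linear and fixes `X` along
the first one. For `𝕜 = ℝ` one has `I = 0`, and the second one is trivial. -/
theorem exists_isOneParameterSubgroup_of_isScalarTower [CompleteSpace E] (X : E) :
    ∃ γ : 𝕜 → D, IsOneParameterSubgroup 𝕜 γ X := by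
  have := lieGroup_restrictScalars 𝕜 (E := E) (D := D)
  obtain ⟨γ₁, h₁⟩ := exists_isOneParameterSubgroup_real (D := D) X
  obtain ⟨γ₂, h₂⟩ := exists_isOneParameterSubgroup_real (D := D) ((RCLike.I : 𝕜) • X)
  have hcomm : ∀ s t, γ₁ s * γ₂ t = γ₂ t * γ₁ s := by
    intro s t
    have h3 := h₂.conj_restrictScalars 𝕜 (γ₁ s)
    rw [map_smul, h₁.AdL_self 𝕜 s] at h3
    have := congrFun (h3.unique h₂) t
    exact mul_inv_eq_iff_eq_mul.1 this
  have hmap : ∀ s t : 𝕜, γ₁ (RCLike.re (s + t)) * γ₂ (RCLike.im (s + t)) =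
      γ₁ (RCLike.re s) * γ₂ (RCLike.im s) * (γ₁ (RCLike.re t) * γ₂ (RCLike.im t)) := by
    intro s t
    rw [_root_.map_add, _root_.map_add, h₁.map_add, h₂.map_add]
    simp only [mul_assoc]
    rw [← mul_assoc (γ₂ _) (γ₁ _), ← hcomm, mul_assoc]
  have hre : HasFDerivAt (𝕜 := ℝ) (fun z : 𝕜 => extChartAt 𝓘(ℝ, E) (1 : D) (γ₁ (RCLike.re z)))
      (((1 : ℝ →L[ℝ] ℝ).smulRight X : ℝ →L[ℝ] E).comp (RCLike.reCLM (K := 𝕜))) 0 := by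
    have h := h₁.hasFDerivAt_chart
    rw [← map_zero (RCLike.reCLM (K := 𝕜))] at h
    exact h.comp (0 : 𝕜) (RCLike.reCLM (K := 𝕜)).hasFDerivAt
  have him : HasFDerivAt (𝕜 := ℝ) (fun z : 𝕜 => extChartAt 𝓘(ℝ, E) (1 : D) (γ₂ (RCLike.im z)))
      (((1 : ℝ →L[ℝ] ℝ).smulRight ((RCLike.I : 𝕜) • X) : ℝ →L[ℝ] E).comp
        (RCLike.imCLM (K := 𝕜))) 0 := by
    have h := h₂.hasFDerivAt_chart
    rw [← map_zero (RCLike.imCLM (K := 𝕜))] at h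
    exact h.comp (0 : 𝕜) (RCLike.imCLM (K := 𝕜)).hasFDerivAt
  have hc1 : Tendsto (fun z : 𝕜 => γ₁ (RCLike.re z)) (𝓝 0) (𝓝 1) := by
    have := h₁.continuousAt_zero
    rw [ContinuousAt, h₁.map_zero] at this
    exact this.comp (by simpa using (RCLike.continuous_re (K := 𝕜)).tendsto 0)
  have hc2 : Tendsto (fun z : 𝕜 => γ₂ (RCLike.im z)) (𝓝 0) (𝓝 1) := by
    have := h₂.continuousAt_zero
    rw [ContinuousAt, h₂.map_zero] at this
    exact this.comp (by simpa using (RCLike.continuous_im (K := 𝕜)).tendsto 0)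
  have h0 : γ₁ (RCLike.re (0 : 𝕜)) * γ₂ (RCLike.im (0 : 𝕜)) = 1 := by
    simp [h₁.map_zero, h₂.map_zero]
  refine ⟨fun z => γ₁ (RCLike.re z) * γ₂ (RCLike.im z), hmap,
    (hasMFDerivAt_iff_chart (v := (0 : 𝕜))
      (f := fun z : 𝕜 => γ₁ (RCLike.re z) * γ₂ (RCLike.im z)) h0).2 ⟨?_, ?_⟩⟩
  · have := topologicalGroup_of_lieGroup 𝓘(ℝ, E) ∞ (G := D)
    rw [ContinuousAt, h0]
    simpa using hc1.mul hc2
  · have hm : HasFDerivAt (chartMul ℝ E D)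
        (ContinuousLinearMap.fst ℝ E E + ContinuousLinearMap.snd ℝ E E)
        (extChartAt 𝓘(ℝ, E) (1 : D) (γ₁ (RCLike.re (0 : 𝕜))),
        extChartAt 𝓘(ℝ, E) (1 : D) (γ₂ (RCLike.im (0 : 𝕜)))) := by
      rw [RCLike.zero_re, RCLike.zero_im, h₁.map_zero, h₂.map_zero]
      exact (hasStrictFDerivAt_chartMul_one ℝ E D).hasFDerivAt
    have h := HasFDerivAt.comp (f := fun z : 𝕜 => (extChartAt 𝓘(ℝ, E) (1 : D) (γ₁ (RCLike.re z)),
      extChartAt 𝓘(ℝ, E) (1 : D) (γ₂ (RCLike.im z)))) (0 : 𝕜) hm (hre.prodMk him)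
    have h' := h.congr_of_eventuallyEq
      (f₁ := fun z : 𝕜 => extChartAt 𝓘(𝕜, E) (1 : D) (γ₁ (RCLike.re z) * γ₂ (RCLike.im z))) (by
        filter_upwards [hc1.eventually (eventually_chart_symm_chart ℝ E D),
          hc2.eventually (eventually_chart_symm_chart ℝ E D)] with z hz1 hz2
        simp only [chartMul, Function.comp_apply]
        rw [hz1, hz2]
        rfl)
    refine hasFDerivAt_of_restrictScalars ℝ h' ?_
    ext z
    have hz : z • X = (RCLike.re z : ℝ) • X + (RCLike.im z : ℝ) • (RCLike.I : 𝕜) • X := by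
      conv_lhs => rw [← RCLike.re_add_im z]
      rw [add_smul, mul_smul, RCLike.real_smul_eq_coe_smul (K := 𝕜),
        RCLike.real_smul_eq_coe_smul (K := 𝕜)]
    simpa using hz

end RestrictScalars

/-- Every tangent vector at `1` is the velocity of a one-parameter subgroup over `𝕜`. The real
structure on `E` is obtained by restriction of scalars. -/
theorem exists_isOneParameterSubgroup (𝕜 : Type*) [RCLike 𝕜] {E : Type*} [NormedAddCommGroup E]
    [NormedSpace 𝕜 E] [CompleteSpace E] {D : Type*} [TopologicalSpace D] [ChartedSpace E D]
    [Group D] [LieGroup 𝓘(𝕜, E) ∞ D] (X : E) :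
    ∃ γ : 𝕜 → D, IsOneParameterSubgroup 𝕜 γ X := by
  let _ : NormedSpace ℝ E := NormedSpace.restrictScalars ℝ 𝕜 E
  have : IsScalarTower ℝ 𝕜 E := RestrictScalars.isScalarTower ℝ 𝕜 E
  exact exists_isOneParameterSubgroup_of_isScalarTower 𝕜 X

/-! ### Exponentials and normalizers -/

section Normalizers

variable {𝕜 : Type*} [RCLike 𝕜] {E : Type*} [NormedAddCommGroup E] [NormedSpace 𝕜 E]
  [CompleteSpace E]
  {D : Type*} [TopologicalSpace D] [ChartedSpace E D] [Group D] [LieGroup 𝓘(𝕜, E) ∞ D]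

/-- A one-parameter group of operators that is differentiable at `0` is an exponential. -/
theorem eq_exp_of_map_add {F : 𝕜 → E →L[𝕜] E} {T : E →L[𝕜] E} (h0 : F 0 = 1)
    (hadd : ∀ s t, F (s + t) = F s * F t) (hF : HasDerivAt F T 0) (t : 𝕜) :
    F t = NormedSpace.exp (t • T) := by
  have hd : ∀ t, HasDerivAt F (F t * T) t := by
    intro t
    have h1 : HasDerivAt (fun s => F (s - t)) T t := by
      rw [← sub_self t] at hF
      exact hF.comp_sub_const t t
    have h2 := h1.const_mul (F t)
    have e : (fun s => F t * F (s - t)) = F := by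
      ext1 s
      rw [← hadd, add_sub_cancel]
    rwa [e] at h2
  have hexp : ∀ t : 𝕜, HasDerivAt (fun s : 𝕜 => NormedSpace.exp (s • (-T)))
      ((-T) * NormedSpace.exp (t • (-T))) t := fun t => hasDerivAt_exp_smul_const' (-T) t
  have hG : ∀ t, HasDerivAt (fun s => F s * NormedSpace.exp (s • (-T))) 0 t := by
    intro t
    have h3 := (hd t).mul (hexp t)
    have e : F t * T * NormedSpace.exp (t • -T) + F t * (-T * NormedSpace.exp (t • -T)) = 0 := by
      noncomm_ring
    rwa [e] at h3
  -- `F t` and `exp (-t T)` are inverse to each other, as are `F t` and `F (-t)`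
  have hconst : ∀ t, F t * NormedSpace.exp (t • (-T)) = 1 := by
    intro t
    have h4 := is_const_of_deriv_eq_zero (fun t => (hG t).differentiableAt)
      (fun t => (hG t).deriv) t 0
    simpa [h0] using h4
  have h5 : F t * F (-t) = 1 := by rw [← hadd, add_neg_cancel, h0]
  calc F t = F t * (F (-t) * NormedSpace.exp ((-t) • (-T))) := by rw [hconst, mul_one]
    _ = NormedSpace.exp (t • T) := by rw [← mul_assoc, h5, one_mul, neg_smul_neg]

theorem exp_apply_mem {T : E →L[𝕜] E} {W : Submodule 𝕜 E} (hW : IsClosed (W : Set E))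
    (hT : ∀ v ∈ W, T v ∈ W) {v : E} (hv : v ∈ W) : NormedSpace.exp T v ∈ W := by
  have h := (NormedSpace.exp_series_hasSum_exp' (𝕂 := 𝕜) T).mapL
    (ContinuousLinearMap.apply 𝕜 E v)
  have hpow : ∀ n : ℕ, (T ^ n) v ∈ W := by
    intro n
    induction n with
    | zero => simpa using hv
    | succ n ih => rw [pow_succ', mul_apply_eq_comp]; exact hT _ ih
  refine hW.mem_of_tendsto h (Eventually.of_forall fun s => W.sum_mem fun n _ => ?_)
  simpa using W.smul_mem _ (hpow n)

/-- `Ad (γ t) = exp (t ad X)` for a one-parameter subgroup `γ` with velocity `X`. -/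
theorem IsOneParameterSubgroup.AdL_eq_exp {γ : 𝕜 → D} {X : E} (h : IsOneParameterSubgroup 𝕜 γ X)
    {T : E →L[𝕜] E →L[𝕜] E}
    (hT : HasFDerivAt (fun a => AdL 𝕜 E ((extChartAt 𝓘(𝕜, E) (1 : D)).symm a)) T
      (chartOne 𝕜 E D)) (t : 𝕜) :
    AdL 𝕜 E (γ t) = NormedSpace.exp (t • T X) := by
  refine eq_exp_of_map_add (F := fun t => AdL 𝕜 E (γ t)) ?_
    (fun s t => by simp only [h.map_add, AdL_mul]) ?_ t
  · simp only [h.map_zero, AdL_one]; rfl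
  · have hT' : HasFDerivAt (fun a => AdL 𝕜 E ((extChartAt 𝓘(𝕜, E) (1 : D)).symm a)) T
        (extChartAt 𝓘(𝕜, E) (1 : D) (γ 0)) := by
      rw [h.map_zero]; exact hT
    have h1 := (hT'.comp (0 : 𝕜) h.hasFDerivAt_chart).hasDerivAt
    have hγ : Tendsto γ (𝓝 0) (𝓝 1) := by
      have := h.continuousAt_zero
      rwa [ContinuousAt, h.map_zero] at this
    refine (h1.congr_of_eventuallyEq ?_).congr_deriv (by simp)
    filter_upwards [hγ.eventually (eventually_chart_symm_chart 𝕜 E D)] with t ht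
    simp only [Function.comp_apply]
    rw [ht]

/-- A Lie subalgebra of `T₁D`, as a subspace of the model space `E`, to which `T₁D` is equal by
definition. -/
def modelSubmodule (u : LieSubalgebra 𝕜 (GroupLieAlgebra 𝓘(𝕜, E) D)) : Submodule 𝕜 E :=
  u.toSubmodule

variable {u w w' : LieSubalgebra 𝕜 (GroupLieAlgebra 𝓘(𝕜, E) D)}

omit [CompleteSpace E] in
theorem AdL_inv_apply_apply (g : D) (v : E) : AdL 𝕜 E g⁻¹ (AdL 𝕜 E g v) = v := by
  rw [← mul_apply_eq_comp, ← AdL_mul, inv_mul_cancel, AdL_one]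
  rfl

theorem mem_normalizerSubgroup_iff {g : D} : g ∈ normalizerSubgroup u ↔
    (∀ v : E, v ∈ modelSubmodule u → AdL 𝕜 E g v ∈ modelSubmodule u) ∧
      ∀ v : E, v ∈ modelSubmodule u → AdL 𝕜 E g⁻¹ v ∈ modelSubmodule u := by
  have key : ∀ k ∈ normalizerSubgroup u, ∀ v : E, v ∈ modelSubmodule u →
      AdL 𝕜 E k v ∈ modelSubmodule u := by
    intro k hk v hv
    have hk' : u.toSubmodule.map (Ad 𝕜 E k) = u.toSubmodule := hk
    exact hk'.le (Submodule.mem_map_of_mem (f := Ad 𝕜 E k) hv)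
  refine ⟨fun h => ⟨key g h, key g⁻¹ (inv_mem h)⟩, fun ⟨h1, h2⟩ => ?_⟩
  refine le_antisymm ?_ fun v hv => ?_
  · rintro _ ⟨v, hv, rfl⟩
    exact h1 v hv
  · refine ⟨AdL 𝕜 E g⁻¹ v, h2 v hv, ?_⟩
    have := AdL_inv_apply_apply (𝕜 := 𝕜) (E := E) g⁻¹ v
    rwa [inv_inv] at this

theorem connectedSubgroup_mono (h : w ≤ w') : connectedSubgroup w ≤ connectedSubgroup w' :=
  Subgroup.closure_mono fun _ ⟨X, hX, he⟩ => ⟨X, h hX, he⟩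

theorem IsOneParameterSubgroup.mem_connectedSubgroup {γ : 𝕜 → D} {X : E}
    (h : IsOneParameterSubgroup 𝕜 γ X) (hX : X ∈ modelSubmodule w) (t : 𝕜) :
    γ t ∈ connectedSubgroup w := by
  have h2 : IsOneParameterSubgroup 𝕜 (fun s => γ (t * s)) (t • X) := by
    refine ⟨fun s s' => by rw [mul_add, h.map_add], ?_⟩
    have h0 : γ (t * 0) = 1 := by rw [mul_zero, h.map_zero]
    refine (hasMFDerivAt_iff_chart (v := (0 : 𝕜)) (f := fun s => γ (t * s)) h0).2 ⟨?_, ?_⟩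
    · refine ContinuousAt.comp (f := fun s : 𝕜 => t * s) ?_ (by fun_prop)
      rw [mul_zero]; exact h.continuousAt_zero
    · have h1 := h.hasFDerivAt_chart
      rw [← mul_zero t] at h1
      have h3 := HasFDerivAt.comp (f := fun s : 𝕜 => t * s) (0 : 𝕜) h1
        ((hasFDerivAt_id (0 : 𝕜)).const_mul t)
      refine h3.congr_fderiv ?_
      ext
      simp
  have h3 := h2.isExp
  rw [mul_one] at h3
  exact Subgroup.subset_closure ⟨_, (modelSubmodule w).smul_mem t hX, h3⟩

/-- Membership in the Lie normalizer, in terms of the differential `T` of `Ad`. -/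
theorem mem_modelSubmodule_normalizer_iff {T : E →L[𝕜] E →L[𝕜] E}
    (hT : ∀ v w : GroupLieAlgebra 𝓘(𝕜, E) D, T v w = (⁅v, w⁆ : GroupLieAlgebra 𝓘(𝕜, E) D)) {X : E} :
    X ∈ modelSubmodule u.normalizer ↔ ∀ y ∈ modelSubmodule u, T X y ∈ modelSubmodule u := by
  have h : X ∈ modelSubmodule u.normalizer ↔ ∀ y : GroupLieAlgebra 𝓘(𝕜, E) D, y ∈ u →
      ⁅(show GroupLieAlgebra 𝓘(𝕜, E) D from X), y⁆ ∈ u := u.mem_normalizer_iff X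
  rw [h]
  refine forall₂_congr fun y _ => ?_
  have e : T X y = (⁅(show GroupLieAlgebra 𝓘(𝕜, E) D from X), y⁆ : GroupLieAlgebra 𝓘(𝕜, E) D) :=
    hT X y
  rw [e]
  rfl

variable [FiniteDimensional 𝕜 E]

/-- The normalizer of `𝔲` in `D` contains the exponentials of the normalizer of `𝔲` in the Lie
algebra. -/
theorem connectedSubgroup_le_normalizerSubgroup (h : w ≤ u.normalizer) :
    connectedSubgroup w ≤ normalizerSubgroup u := by
  refine (Subgroup.closure_le _).2 ?_
  rintro g ⟨X, hX, he⟩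
  obtain ⟨γ, hγ, rfl⟩ := he.exists_isOneParameterSubgroup
  obtain ⟨T, hT, hd⟩ := hasStrictFDerivAt_AdL (𝕜 := 𝕜) (E := E) (D := D)
  have hcl : IsClosed (modelSubmodule u : Set E) := Submodule.closed_of_finiteDimensional _
  have hmem : ∀ (t : 𝕜) (v : E), v ∈ modelSubmodule u → AdL 𝕜 E (γ t) v ∈ modelSubmodule u := by
    intro t v hv
    rw [hγ.AdL_eq_exp hd.hasFDerivAt]
    refine exp_apply_mem (W := modelSubmodule u) hcl (fun y hy => ?_) hv
    have h1 : T X y ∈ modelSubmodule u :=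
      (mem_modelSubmodule_normalizer_iff hT).1 (h hX) y hy
    exact (modelSubmodule u).smul_mem t h1
  refine mem_normalizerSubgroup_iff.2 ⟨hmem 1, ?_⟩
  rw [← hγ.map_neg]
  exact hmem (-1)

theorem connectedSubgroup_le_normalizerSubgroup_self :
    connectedSubgroup u ≤ normalizerSubgroup u :=
  connectedSubgroup_le_normalizerSubgroup u.le_normalizer

omit [FiniteDimensional 𝕜 E] in
theorem conj_mem_connectedSubgroup {g h : D} (hg : g ∈ normalizerSubgroup u)
    (hh : h ∈ connectedSubgroup u) : g * h * g⁻¹ ∈ connectedSubgroup u := by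
  have : connectedSubgroup u ≤ (connectedSubgroup u).comap (MulAut.conj g).toMonoidHom := by
    refine (Subgroup.closure_le _).2 ?_
    rintro k ⟨X, hX, he⟩
    obtain ⟨γ, hγ, rfl⟩ := he.exists_isOneParameterSubgroup
    exact (hγ.conj g).mem_connectedSubgroup ((mem_normalizerSubgroup_iff.1 hg).1 X hX) 1
  exact this hh

omit [FiniteDimensional 𝕜 E] in
theorem normalizerSubgroup_le_normalizer :
    normalizerSubgroup u ≤ Subgroup.normalizer (connectedSubgroup u : Set D) := by
  intro g hg
  refine Subgroup.mem_normalizer_iff.2 fun h =>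
    ⟨fun hh => conj_mem_connectedSubgroup hg hh, fun hh => ?_⟩
  have := conj_mem_connectedSubgroup (inv_mem hg) hh
  simpa [mul_assoc] using this

end Normalizers

/-! ### A neighbourhood of `1` in the normalizer -/

section LocalLifts

variable {𝕜 : Type*} [RCLike 𝕜] {E : Type*} [NormedAddCommGroup E] [NormedSpace 𝕜 E]
  {D : Type*} [TopologicalSpace D] [ChartedSpace E D] [Group D]

/-- `f` maps `0` to `1`, and its strict derivative at `0` is `L`, in the chart at `1`. -/
structure HasChartDerivAtZero (f : E → D) (L : E →L[𝕜] E) : Prop where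
  map_zero : f 0 = 1
  continuousAt : ContinuousAt f 0
  hasStrictFDerivAt : HasStrictFDerivAt (fun v => extChartAt 𝓘(𝕜, E) (1 : D) (f v)) L 0

theorem HasChartDerivAtZero.tendsto {f : E → D} {L : E →L[𝕜] E} (h : HasChartDerivAtZero f L) :
    Tendsto f (𝓝 0) (𝓝 1) := by
  have := h.continuousAt
  rwa [ContinuousAt, h.map_zero] at this

theorem hasChartDerivAtZero_one : HasChartDerivAtZero (fun _ : E => (1 : D)) (0 : E →L[𝕜] E) :=
  ⟨rfl, continuousAt_const, hasStrictFDerivAt_const _ _⟩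

/-- For a linear form `l`, the map `v ↦ exp (l v • X)` has derivative `l ⊗ X`: these rank one maps are
the building blocks of the coordinates used near `1`. -/
theorem IsOneParameterSubgroup.hasChartDerivAtZero [LieGroup 𝓘(𝕜, E) ∞ D] {γ : 𝕜 → D} {X : E}
    (h : IsOneParameterSubgroup 𝕜 γ X) (l : E →L[𝕜] 𝕜) :
    HasChartDerivAtZero (fun v => γ (l v)) (l.smulRight X) := by
  refine ⟨by rw [_root_.map_zero, h.map_zero], ?_, ?_⟩
  · refine ContinuousAt.comp (f := l) ?_ l.continuous.continuousAt
    rw [_root_.map_zero]; exact h.continuousAt_zero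
  · have h1 := h.hasStrictFDerivAt_chart
    rw [← _root_.map_zero l] at h1
    refine (h1.comp (0 : E) l.hasStrictFDerivAt).congr_fderiv ?_
    ext v
    simp

theorem HasChartDerivAtZero.mul [LieGroup 𝓘(𝕜, E) ∞ D] {f g : E → D} {L M : E →L[𝕜] E}
    (hf : HasChartDerivAtZero f L) (hg : HasChartDerivAtZero g M) :
    HasChartDerivAtZero (fun v => f v * g v) (L + M) := by
  have := topologicalGroup_of_lieGroup 𝓘(𝕜, E) ∞ (G := D)
  refine ⟨by rw [hf.map_zero, hg.map_zero, mul_one], hf.continuousAt.mul hg.continuousAt, ?_⟩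
  have hm : HasStrictFDerivAt (chartMul 𝕜 E D)
      (ContinuousLinearMap.fst 𝕜 E E + ContinuousLinearMap.snd 𝕜 E E)
      (extChartAt 𝓘(𝕜, E) (1 : D) (f 0), extChartAt 𝓘(𝕜, E) (1 : D) (g 0)) := by
    rw [hf.map_zero, hg.map_zero]
    exact hasStrictFDerivAt_chartMul_one 𝕜 E D
  have h := HasStrictFDerivAt.comp (f := fun v => (extChartAt 𝓘(𝕜, E) (1 : D) (f v),
    extChartAt 𝓘(𝕜, E) (1 : D) (g v))) (0 : E) hm
    (hf.hasStrictFDerivAt.prodMk hg.hasStrictFDerivAt)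
  refine (h.congr_of_eventuallyEq ?_).congr_fderiv (by ext; simp)
  filter_upwards [hf.tendsto.eventually (eventually_chart_symm_chart 𝕜 E D),
    hg.tendsto.eventually (eventually_chart_symm_chart 𝕜 E D)] with v h1 h2
  simp only [chartMul]
  rw [h1, h2]

theorem hasChartDerivAtZero_chart_symm (L : E →L[𝕜] E) :
    HasChartDerivAtZero (fun v => (extChartAt 𝓘(𝕜, E) (1 : D)).symm (chartOne 𝕜 E D + L v)) L := by
  have ht : Tendsto (fun v => chartOne 𝕜 E D + L v) (𝓝 0) (𝓝 (chartOne 𝕜 E D)) := by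
    have : Continuous fun v => chartOne 𝕜 E D + L v := by fun_prop
    simpa using this.tendsto 0
  have h0 : (extChartAt 𝓘(𝕜, E) (1 : D)).symm (chartOne 𝕜 E D + L 0) = 1 := by
    rw [map_zero, add_zero, chartOne_symm]
  refine ⟨h0, ?_, ?_⟩
  · rw [ContinuousAt, h0]
    exact (tendsto_chart_symm 𝕜 E D).comp ht
  · refine (L.hasStrictFDerivAt.const_add (chartOne 𝕜 E D)).congr_of_eventuallyEq ?_
    filter_upwards [ht.eventually (eventually_chart_chart_symm 𝕜 E D)] with v hv
    exact hv.symm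

variable [CompleteSpace E] [LieGroup 𝓘(𝕜, E) ∞ D] [FiniteDimensional 𝕜 E]
  {u u' w : LieSubalgebra 𝕜 (GroupLieAlgebra 𝓘(𝕜, E) D)}

/-- A linear map into a Lie subalgebra is the derivative of a map into the corresponding connected
subgroup: a product of one-parameter subgroups. -/
theorem exists_hasChartDerivAtZero_mem_connectedSubgroup (L : E →L[𝕜] E)
    (hL : ∀ v, L v ∈ modelSubmodule w) :
    ∃ f : E → D, HasChartDerivAtZero f L ∧ ∀ v, f v ∈ connectedSubgroup w := by
  let b := Module.finBasis 𝕜 E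
  let l (i) : E →L[𝕜] 𝕜 := (b.coord i).toContinuousLinearMap
  have hsum : L = ∑ i, (l i).smulRight (L (b i)) := by
    ext v
    conv_lhs => rw [← b.sum_repr v, map_sum]
    simp [l]
  rw [hsum]
  refine Finset.sum_induction _
    (fun L => ∃ f : E → D, HasChartDerivAtZero f L ∧ ∀ v, f v ∈ connectedSubgroup w) ?_ ?_ ?_
  · rintro L M ⟨f, hf, hf'⟩ ⟨g, hg, hg'⟩
    exact ⟨_, hf.mul hg, fun v => mul_mem (hf' v) (hg' v)⟩
  · exact ⟨_, hasChartDerivAtZero_one, fun _ => one_mem _⟩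
  · intro i _
    obtain ⟨γ, hγ⟩ := exists_isOneParameterSubgroup 𝕜 (D := D) (L (b i))
    exact ⟨_, hγ.hasChartDerivAtZero (l i), fun v => hγ.mem_connectedSubgroup (hL _) _⟩

omit [FiniteDimensional 𝕜 E] in
/-- If `G` vanishes at `0` and its derivative is injective on the range of a projection `R`, with
kernel that of `R`, then `0` is an isolated zero of `G` in the range of `R`. -/
theorem eventually_eq_zero_of_map_eq_zero {V : Type*} [NormedAddCommGroup V] [NormedSpace 𝕜 V]
    [FiniteDimensional 𝕜 V] {G : E → V} {G' : E →L[𝕜] V} (hG : HasStrictFDerivAt G G' 0)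
    (hG0 : G 0 = 0) {R : E →L[𝕜] E} (hR : ∀ v, R (R v) = R v)
    (hker : ∀ v, G' (R v) = 0 → R v = 0) (hker' : ∀ v, R v = 0 → G' v = 0) :
    ∀ᶠ v in 𝓝 (0 : E), G (R v) = 0 → R v = 0 := by
  have hinj : LinearMap.ker (G'.toLinearMap ∘ₗ (LinearMap.range R.toLinearMap).subtype) = ⊥ := by
    rw [LinearMap.ker_eq_bot']
    rintro ⟨_, v, rfl⟩ hv
    exact Subtype.ext (hker v hv)
  obtain ⟨Λ₀, hΛ₀⟩ := LinearMap.exists_leftInverse_of_injective _ hinj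
  let Λ : V →L[𝕜] E := ((LinearMap.range R.toLinearMap).subtype ∘ₗ Λ₀).toContinuousLinearMap
  have hΛ : ∀ v, Λ (G' v) = R v := by
    intro v
    have h1 : G' v = G' (R v) := by
      have := hker' (v - R v) (by rw [map_sub, hR, sub_self])
      rwa [map_sub, sub_eq_zero] at this
    have h2 := LinearMap.congr_fun hΛ₀ ⟨R v, v, rfl⟩
    rw [h1]
    exact congrArg Subtype.val h2
  -- `Λ` inverts `G'` on the range of `R`, so that `v ↦ Λ (G v) + (v - R v)` has derivative `1` and is
  -- injective near `0`; it vanishes at `0` and at every point of the range of `R` where `G` does.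
  have hH : HasStrictFDerivAt (fun v => Λ (G v) + (v - R v))
      ((ContinuousLinearEquiv.refl 𝕜 E : E ≃L[𝕜] E) : E →L[𝕜] E) 0 := by
    refine ((Λ.hasStrictFDerivAt.comp (0 : E) hG).add
      ((hasStrictFDerivAt_id (0 : E)).sub R.hasStrictFDerivAt)).congr_fderiv ?_
    ext v
    simp [hΛ]
  have hR0 : Tendsto R (𝓝 0) (𝓝 0) := by simpa using R.continuous.tendsto 0
  filter_upwards [hR0.eventually hH.eventually_left_inverse] with v hv hGv
  have h0 := hH.eventually_left_inverse.self_of_nhds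
  simp only [hGv, hR, sub_self, map_zero, add_zero] at hv
  simp only [hG0, sub_self, map_zero, add_zero] at h0
  exact hv.symm.trans h0

/-- Near `1`, the normalizer of `𝔲` is contained in the subgroup generated by the exponentials of
`𝔲` and of `n(𝔲) ∩ 𝔲'`. -/
theorem eventually_mem_sup_of_mem_normalizerSubgroup
    (huu' : IsCompl (modelSubmodule u) (modelSubmodule u')) :
    ∀ᶠ g in 𝓝 (1 : D), g ∈ normalizerSubgroup u →
      g ∈ connectedSubgroup u ⊔ connectedSubgroup (u.normalizer ⊓ u') := by
  obtain ⟨T, hT, hd⟩ := hasStrictFDerivAt_AdL (𝕜 := 𝕜) (E := E) (D := D)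
  obtain ⟨C, hC⟩ := (modelSubmodule u.normalizer).exists_isCompl
  -- `P` is the projection to `𝔲` along `𝔲'`, and `R` the projection to a complement of the
  -- normalizer of `𝔲` along this normalizer.
  let P : E →L[𝕜] E := ((modelSubmodule u).projection _ huu').toContinuousLinearMap
  let R : E →L[𝕜] E := (C.projection _ hC.symm).toContinuousLinearMap
  have hPmem : ∀ v, P v ∈ modelSubmodule u := fun v =>
    Submodule.projection_apply_mem huu' v
  have hPid : ∀ v ∈ modelSubmodule u, P v = v := fun v hv =>
    Submodule.projection_apply_of_mem_left huu' hv
  have hPu' : ∀ v, v - P v ∈ modelSubmodule u' := fun v => Submodule.sub_projection_mem huu' v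
  have hRR : ∀ v, R (R v) = R v := fun v =>
    Submodule.projection_apply_of_mem_left hC.symm (Submodule.projection_apply_mem hC.symm v)
  have hRker : ∀ v, R v = 0 ↔ v ∈ modelSubmodule u.normalizer := fun v =>
    Submodule.projection_apply_eq_zero_iff hC.symm
  have hsubR : ∀ v, v - R v ∈ modelSubmodule u.normalizer := fun v => by
    rw [← hRker, map_sub, hRR, sub_self]
  have hle : modelSubmodule u ≤ modelSubmodule u.normalizer := u.le_normalizer
  -- The identity is the sum of the maps `P (1 - R)` into `𝔲`, `(1 - P) (1 - R)` into `n(𝔲) ∩ 𝔲'`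
  -- and `R`; the product of the maps to `D` with these derivatives is a local parametrization.
  obtain ⟨f₁, hf₁, hf₁m⟩ := exists_hasChartDerivAtZero_mem_connectedSubgroup (D := D) (w := u)
    (P.comp (ContinuousLinearMap.id 𝕜 E - R)) fun v => hPmem _
  obtain ⟨f₂, hf₂, hf₂m⟩ := exists_hasChartDerivAtZero_mem_connectedSubgroup (D := D)
    (w := u.normalizer ⊓ u')
    ((ContinuousLinearMap.id 𝕜 E - P).comp (ContinuousLinearMap.id 𝕜 E - R)) fun v =>
      (⟨(modelSubmodule u.normalizer).sub_mem (hsubR v) (hle (hPmem _)), hPu' _⟩ :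
        (v - R v) - P (v - R v) ∈ modelSubmodule u.normalizer ⊓ modelSubmodule u')
  have hf₃ := hasChartDerivAtZero_chart_symm (D := D) R
  have hf := (hf₁.mul hf₂).mul hf₃
  have hstrict : HasStrictFDerivAt _ ((ContinuousLinearEquiv.refl 𝕜 E : E ≃L[𝕜] E) : E →L[𝕜] E) 0 :=
    hf.hasStrictFDerivAt.congr_fderiv (by ext v; simp; abel)
  have hmap := hstrict.map_nhds_eq_of_equiv
  rw [hf.map_zero] at hmap
  -- `K S = (1 - P) S P` vanishes exactly when the operator `S` maps `𝔲` into `𝔲`.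
  let K : (E →L[𝕜] E) →L[𝕜] E →L[𝕜] E :=
    (ContinuousLinearMap.compL 𝕜 E E E (ContinuousLinearMap.id 𝕜 E - P)).comp
      ((ContinuousLinearMap.compL 𝕜 E E E).flip P)
  have hK : ∀ S v, K S v = S (P v) - P (S (P v)) := fun S v => by simp [K]
  have hG : HasStrictFDerivAt
      (fun v => K (AdL 𝕜 E ((extChartAt 𝓘(𝕜, E) (1 : D)).symm (chartOne 𝕜 E D + v))))
      (K.comp T) 0 := by
    have hd' : HasStrictFDerivAt (fun a => AdL 𝕜 E ((extChartAt 𝓘(𝕜, E) (1 : D)).symm a)) T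
        (chartOne 𝕜 E D + 0) := by rwa [add_zero]
    exact K.hasStrictFDerivAt.comp (0 : E)
      (hd'.comp (0 : E) ((hasStrictFDerivAt_id (0 : E)).const_add (chartOne 𝕜 E D)))
  have hG0 : K (AdL 𝕜 E ((extChartAt 𝓘(𝕜, E) (1 : D)).symm (chartOne 𝕜 E D + 0))) = 0 := by
    ext v
    rw [add_zero, chartOne_symm, AdL_one, hK]
    simp [hPid _ (hPmem v)]
  have hKT : ∀ X, K (T X) = 0 ↔ X ∈ modelSubmodule u.normalizer := by
    intro X
    rw [mem_modelSubmodule_normalizer_iff hT]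
    constructor
    · intro h y hy
      have h1 := DFunLike.congr_fun h y
      rw [hK, hPid y hy] at h1
      rw [sub_eq_zero.1 h1]
      exact hPmem _
    · intro h
      ext y
      rw [hK, hPid _ (h _ (hPmem y)), sub_self]
      rfl
  have hslice := eventually_eq_zero_of_map_eq_zero hG hG0 hRR
    (fun v hv => by rw [← hRR]; exact (hRker _).2 ((hKT _).1 hv))
    (fun v hv => (hKT v).2 ((hRker v).1 hv))
  have hU := connectedSubgroup_le_normalizerSubgroup_self (u := u)
  have hA : connectedSubgroup (u.normalizer ⊓ u') ≤ normalizerSubgroup u :=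
    connectedSubgroup_le_normalizerSubgroup inf_le_left
  have hchart : ∀ᶠ a in 𝓝 (chartOne 𝕜 E D),
      (extChartAt 𝓘(𝕜, E) (1 : D)).symm a ∈ normalizerSubgroup u →
        (extChartAt 𝓘(𝕜, E) (1 : D)).symm a ∈
          connectedSubgroup u ⊔ connectedSubgroup (u.normalizer ⊓ u') := by
    have hmap' : 𝓝 (chartOne 𝕜 E D) = _ := hmap.symm
    rw [hmap', eventually_map]
    filter_upwards [hslice, hf.tendsto.eventually (eventually_chart_symm_chart 𝕜 E D)]
      with v hv hv' hN
    rw [hv'] at hN ⊢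
    have h3 := (Subgroup.mul_mem_cancel_left _
      (mul_mem (hU (hf₁m v)) (hA (hf₂m v)))).1 hN
    have h4 : R v = 0 := hv (by
      ext y
      rw [hK, hPid _ ((mem_normalizerSubgroup_iff.1 h3).1 _ (hPmem y)), sub_self]
      rfl)
    rw [h4, add_zero, chartOne_symm, mul_one]
    exact mul_mem (Subgroup.mem_sup_left (hf₁m v)) (Subgroup.mem_sup_right (hf₂m v))
  filter_upwards [(tendsto_chart 𝕜 E D).eventually hchart, eventually_chart_symm_chart 𝕜 E D]
    with g hg hg'
  rwa [hg'] at hg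

end LocalLifts

/-! ### Decomposition of the normalizers and transitivity on orbit intersections -/

/-- A subgroup `H` of a connected subgroup `N` that contains a neighbourhood of `1` in `N` is all
of `N`. -/
theorem le_of_isConnected_of_eventually_mem {D : Type*} [TopologicalSpace D] [Group D]
    [IsTopologicalGroup D] {N H : Subgroup D} (hN : IsConnected (N : Set D))
    (h : ∀ᶠ g in 𝓝 (1 : D), g ∈ N → g ∈ H) : N ≤ H := by
  have : ConnectedSpace N := Subtype.connectedSpace hN
  have hopen : IsOpen (H.subgroupOf N : Set N) := by
    refine Subgroup.isOpen_of_mem_nhds _ (g := 1) ?_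
    have ht : Tendsto (Subtype.val : N → D) (𝓝 1) (𝓝 1) := continuous_subtype_val.tendsto (1 : N)
    filter_upwards [ht.eventually h] with g hg
    exact hg g.2
  have huniv := IsClopen.eq_univ ⟨Subgroup.isClosed_of_isOpen _ hopen, hopen⟩ ⟨1, one_mem _⟩
  exact Subgroup.subgroupOf_eq_top.1 (SetLike.coe_injective huniv)

section

variable {𝕜 : Type*} [RCLike 𝕜] {E : Type*} [NormedAddCommGroup E] [NormedSpace 𝕜 E]
  [CompleteSpace E] [FiniteDimensional 𝕜 E]
  {D : Type*} [TopologicalSpace D] [ChartedSpace E D] [Group D] [LieGroup 𝓘(𝕜, E) ∞ D]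
  {u u' : LieSubalgebra 𝕜 (GroupLieAlgebra 𝓘(𝕜, E) D)}

/-- If `N(𝔲)` is connected then `N(𝔲) = U A`, where `A` is the connected subgroup with Lie algebra
`n(𝔲) ∩ 𝔲'`. -/
theorem exists_mul_eq_of_mem_normalizerSubgroup
    (huu' : IsCompl u.toSubmodule u'.toSubmodule)
    (hN : IsConnected (normalizerSubgroup u : Set D)) {g : D} (hg : g ∈ normalizerSubgroup u) :
    ∃ h ∈ connectedSubgroup u, ∃ a ∈ connectedSubgroup (u.normalizer ⊓ u'), h * a = g := by
  have := topologicalGroup_of_lieGroup 𝓘(𝕜, E) ∞ (G := D)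
  have hA : connectedSubgroup (u.normalizer ⊓ u') ≤ Subgroup.normalizer (connectedSubgroup u) :=
    (connectedSubgroup_le_normalizerSubgroup inf_le_left).trans normalizerSubgroup_le_normalizer
  have hmem := le_of_isConnected_of_eventually_mem hN
    (eventually_mem_sup_of_mem_normalizerSubgroup huu') hg
  rw [← SetLike.mem_coe, Subgroup.coe_mul_of_right_le_normalizer_left _ _ hA] at hmem
  exact Set.mem_mul.1 hmem

end

section Orbits

variable {D X : Type*} [Group D] [MulAction D X]

theorem smul_image_orbit {A : Subgroup D} {g : D} (hg : g ∈ Subgroup.normalizer (A : Set D)) (q : X) :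
    (fun y => g • y) '' MulAction.orbit A q = MulAction.orbit A (g • q) := by
  ext y
  constructor
  · rintro ⟨_, ⟨a, rfl⟩, rfl⟩
    refine ⟨⟨g * a * g⁻¹, (Subgroup.mem_normalizer_iff.1 hg a).1 a.2⟩, ?_⟩
    simp [Subgroup.smul_def, mul_smul]
  · rintro ⟨a, rfl⟩
    refine ⟨(g⁻¹ * a * g) • q, ⟨⟨g⁻¹ * a * g, ?_⟩, rfl⟩, ?_⟩
    · exact (Subgroup.mem_normalizer_iff''.1 hg a).1 a.2
    · simp [Subgroup.smul_def, mul_smul]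

theorem eq_inter_orbit_of_mem {A A' : Subgroup D} {S : Set X} {y z q : X}
    (hS : S = MulAction.orbit A y ∩ MulAction.orbit A' z) (hq : q ∈ S) :
    S = MulAction.orbit A q ∩ MulAction.orbit A' q := by
  rw [hS] at hq ⊢
  rw [MulAction.orbit_eq_iff.2 hq.1, MulAction.orbit_eq_iff.2 hq.2]

/-- The group-theoretic core: `N = U A` and `N' = U' A'`, with `A ≤ U' ∩ N` and `A' ≤ U ∩ N'`,
force `N ∩ N'` to act transitively on the intersections of `U`-orbits and `U'`-orbits in
`N p ∩ N' p`. -/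
theorem orbitIntersections_transitive {N N' U U' A A' : Subgroup D}
    (hU : U ≤ N) (hU' : U' ≤ N') (hnU : N ≤ Subgroup.normalizer (U : Set D))
    (hnU' : N' ≤ Subgroup.normalizer (U' : Set D))
    (hAU : A ≤ U') (hA : A ≤ N) (hAU' : A' ≤ U) (hA' : A' ≤ N')
    (hN : ∀ g ∈ N, ∃ h ∈ U, ∃ a ∈ A, h * a = g)
    (hN' : ∀ g ∈ N', ∃ h ∈ U', ∃ a ∈ A', h * a = g) (p : X) :
    let 𝒮 := orbitIntersections U U' (MulAction.orbit N p ∩ MulAction.orbit N' p)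
    (∀ g ∈ N ⊓ N', ∀ S ∈ 𝒮, (fun q => g • q) '' S ∈ 𝒮) ∧
      𝒮.Nonempty ∧
      ∀ S ∈ 𝒮, ∀ T ∈ 𝒮, ∃ g ∈ N ⊓ N', (fun q => g • q) '' S = T := by
  have himage : ∀ g ∈ N ⊓ N', ∀ y z : X,
      (fun q => g • q) '' (MulAction.orbit U y ∩ MulAction.orbit U' z) =
        MulAction.orbit U (g • y) ∩ MulAction.orbit U' (g • z) := by
    intro g hg y z
    rw [Set.image_inter (MulAction.injective g), smul_image_orbit (hnU hg.1),
      smul_image_orbit (hnU' hg.2)]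
  have hbase : ∀ S ∈ orbitIntersections U U' (MulAction.orbit N p ∩ MulAction.orbit N' p),
      ∃ g ∈ N ⊓ N',
        (fun q => g • q) '' (MulAction.orbit U p ∩ MulAction.orbit U' p) = S := by
    rintro S ⟨⟨q, hq⟩, hSp, y, z, hS⟩
    rw [eq_inter_orbit_of_mem hS hq]
    obtain ⟨⟨n, hn⟩, hnq⟩ := (hSp hq).1
    obtain ⟨⟨n', hn'⟩, hnq'⟩ := (hSp hq).2
    obtain ⟨h, hh, a, ha, rfl⟩ := hN n hn
    obtain ⟨h', hh', a', ha', rfl⟩ := hN' n' hn'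
    replace hnq : (h * a) • p = q := hnq
    replace hnq' : (h' * a') • p = q := hnq'
    have hg : a * a' ∈ N ⊓ N' := mul_mem ⟨hA ha, hU' (hAU ha)⟩ ⟨hU (hAU' ha'), hA' ha'⟩
    refine ⟨a * a', hg, ?_⟩
    rw [himage _ hg]
    congr 1
    · -- `q = (h a a'⁻¹ a⁻¹) (a a') p`, where `a a'⁻¹ a⁻¹ ∈ U` because `A ≤ N` normalizes `U`
      have hc : a * a'⁻¹ * a⁻¹ ∈ U :=
        (Subgroup.mem_normalizer_iff.1 (hnU (hA ha)) _).1 (inv_mem (hAU' ha'))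
      refine (MulAction.orbit_eq_iff.2 ⟨⟨h * (a * a'⁻¹ * a⁻¹), mul_mem hh hc⟩, ?_⟩).symm
      rw [← hnq]
      simp [Subgroup.smul_def, smul_smul, mul_assoc]
    · -- `q = (h' a⁻¹) (a a') p`, where `a ∈ U'`
      refine (MulAction.orbit_eq_iff.2 ⟨⟨h' * a⁻¹, mul_mem hh' (inv_mem (hAU ha))⟩, ?_⟩).symm
      rw [← hnq']
      simp [Subgroup.smul_def, smul_smul, mul_assoc]
  refine ⟨?_, ⟨MulAction.orbit U p ∩ MulAction.orbit U' p, ?_, ?_, p, p, rfl⟩, ?_⟩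
  · rintro g hg S ⟨hne, hS, y, z, rfl⟩
    refine ⟨hne.image _, ?_, g • y, g • z, himage g hg y z⟩
    rintro _ ⟨q, hq, rfl⟩
    exact ⟨MulAction.mem_orbit_of_mem_orbit (⟨g, hg.1⟩ : N) (hS hq).1,
      MulAction.mem_orbit_of_mem_orbit (⟨g, hg.2⟩ : N') (hS hq).2⟩
  · exact ⟨p, MulAction.mem_orbit_self p, MulAction.mem_orbit_self p⟩
  · rintro _ ⟨⟨⟨a, ha⟩, rfl⟩, ⟨⟨b, hb⟩, hab⟩⟩
    exact ⟨⟨⟨a, hU ha⟩, rfl⟩, ⟨⟨b, hU' hb⟩, hab⟩⟩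
  · intro S hS T hT
    obtain ⟨g, hg, rfl⟩ := hbase S hS
    obtain ⟨k, hk, rfl⟩ := hbase T hT
    refine ⟨k * g⁻¹, mul_mem hk (inv_mem hg), ?_⟩
    rw [Set.image_image]
    simp [smul_smul]

end Orbits

end PoissonOrbits

theorem mainTheorem11 {𝕜 : Type*} [RCLike 𝕜]
    {E : Type*} [NormedAddCommGroup E] [NormedSpace 𝕜 E] [FiniteDimensional 𝕜 E] [CompleteSpace E]
    {D : Type*} [TopologicalSpace D] [ChartedSpace E D] [Group D] [LieGroup 𝓘(𝕜, E) ∞ D]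
    [ConnectedSpace D]
    (B : LinearMap.BilinForm 𝕜 (GroupLieAlgebra 𝓘(𝕜, E) D)) (hB : PoissonOrbits.IsQuadratic B)
    (u u' : LieSubalgebra 𝕜 (GroupLieAlgebra 𝓘(𝕜, E) D))
    (hu : PoissonOrbits.IsLagrangianSplitting B u u')
    {n : ℕ} (x : Module.Basis (Fin n) 𝕜 u) (ξ : Module.Basis (Fin n) 𝕜 u')
    (hxξ : PoissonOrbits.IsDual B x ξ)
    (hN : IsConnected (PoissonOrbits.normalizerSubgroup u : Set D))
    (hN' : IsConnected (PoissonOrbits.normalizerSubgroup u' : Set D))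
    {X : Type*} [TopologicalSpace X] [PoissonOrbits.PoissonSpace 𝕜 X] [MulAction D X]
    (hX : PoissonOrbits.IsPoissonAction x ξ X) (p : X) :
    let N := PoissonOrbits.normalizerSubgroup u
    let N' := PoissonOrbits.normalizerSubgroup u'
    let 𝒮 := PoissonOrbits.orbitIntersections (PoissonOrbits.connectedSubgroup u)
      (PoissonOrbits.connectedSubgroup u') (MulAction.orbit N p ∩ MulAction.orbit N' p)
    (∀ g ∈ N ⊓ N', ∀ S ∈ 𝒮, (fun q => g • q) '' S ∈ 𝒮) ∧
      𝒮.Nonempty ∧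
      ∀ S ∈ 𝒮, ∀ T ∈ 𝒮, ∃ g ∈ N ⊓ N', (fun q => g • q) '' S = T := by
  exact PoissonOrbits.orbitIntersections_transitive
    PoissonOrbits.connectedSubgroup_le_normalizerSubgroup_self
    PoissonOrbits.connectedSubgroup_le_normalizerSubgroup_self
    PoissonOrbits.normalizerSubgroup_le_normalizer PoissonOrbits.normalizerSubgroup_le_normalizer
    (PoissonOrbits.connectedSubgroup_mono inf_le_right)
    (PoissonOrbits.connectedSubgroup_le_normalizerSubgroup inf_le_left)
    (PoissonOrbits.connectedSubgroup_mono inf_le_right)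
    (PoissonOrbits.connectedSubgroup_le_normalizerSubgroup inf_le_left)
    (fun _ => PoissonOrbits.exists_mul_eq_of_mem_normalizerSubgroup hu.isCompl hN)
    (fun _ => PoissonOrbits.exists_mul_eq_of_mem_normalizerSubgroup hu.isCompl.symm hN') p
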